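/- Let $n\ge 2$, let $h_1,\dots,h_n$ be the standard basis of $\mathbb R^n$, let $\Delta(B_n)=\{\pm h_i\}\cup\{\pm h_i\pm h_j : i<j\}$ and $\Delta(D_n)=\{\pm h_i\pm h_j : i<j\}$, and let $W(B_n)$, $W(D_n)\subset O(n)$ be the groups generated by the reflections in the hyperplanes orthogonal to the vectors of $\Delta(B_n)$, respectively $\Delta(D_n)$. A spherical simplex in $S^{n-1}$ is a set $\{x\in S^{n-1} : \langle f_i,x\rangle\le 0,\ i=1,\dots,n\}$, where $f_1,\dots,f_n$ are linearly independent unit vectors. Its facet hyperplanes cut $S^{n-1}$ into the $2^n$ simplices with outward facet normals $\pm f_1,\dots,\pm f_n$; this set of simplices is called a *family*, and $\pm f_1,\dots,\pm f_n$ are the normals of the family. All simplices of a family generate the same group, the group generated by the reflections in their facets. Families are considered up to isometries of $S^{n-1}$, and a family *generates* $B_n$ if the group that it generates is conjugate to $W(B_n)$ in $O(n)$. A family is *embedded* in $B_n$ if each of its normals is a scalar multiple of a vector of $\Delta(B_n)$. The *graph* of an embedded family has vertices $1,\dots,n$; there is one edge joining $i$ and $j$ ($i\neq j$) for each of $h_i+h_j$,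 $h_i-h_j$ that is, up to scaling, a normal of the family (so there may be two edges); the vertex $i$ is *marked* if $h_i$ is a normal of the family. **Theorem 2.** Let $n\ge 2$. (1) Every family generating $B_n$ is isometric to a family embedded in $B_n$. (2) For an embedded family the following are equivalent: it generates $B_n$; it generates the whole group $W(B_n)$; its graph is a tree (without double edges) with exactly one marked vertex. (3) Sending an embedded family to its graph induces a one-to-one correspondence between the isometry classes of families generating $B_n$ and the isomorphism classes of trees with $n$ vertices exactly one of which is marked. An embedded family generating $B_n$ is isometric to another embedded family if and only if some element of $W(B_n)$ maps it to that family. (4) If $R$ is a proper reflection subgroup of $W(B_n)$ of maximal rank (that is, fixing only the origin), then no family generating a conjugate of $R$ in $O(n)$ generates $B_n$, and no embedded family among these has a tree with exactly one marked vertex as its graph. The group $W(D_n)$ is such a subgroup $R$. -/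

import Mathlib

namespace SphericalFamilies

/-- The Euclidean space `E^n`; the sphere `S^(n-1)` is its unit sphere. -/
abbrev E (n : ℕ) : Type := EuclideanSpace ℝ (Fin n)

/-- Isometries of the sphere `S^(n-1)`, i.e. linear isometries of `E^n`. -/
abbrev Isom (n : ℕ) : Type := E n ≃ₗᵢ[ℝ] E n

/-! ### Spherical simplices, their facets, and the reflection groups they generate -/

/-- A system of `n` linearly independent unit vectors. -/
def IsNormalSystem {n : ℕ} (f : Fin n → E n) : Prop :=
  (∀ i, ‖f i‖ = 1) ∧ LinearIndependent ℝ f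

/-- The intersection of the unit sphere with the cone whose outward normals are `f 1, …, f n`. -/
def simplex {n : ℕ} (f : Fin n → E n) : Set (E n) :=
  {x | ‖x‖ = 1 ∧ ∀ i, inner ℝ (f i) x ≤ 0}

/-- `v` is the outward unit normal of a facet of `P`: the set `P` lies on the nonpositive side of
the hyperplane orthogonal to `v` and touches it in a set that spans this hyperplane. -/
def IsFacetNormal {n : ℕ} (P : Set (E n)) (v : E n) : Prop :=
  ‖v‖ = 1 ∧ (∀ x ∈ P, inner ℝ v x ≤ 0) ∧
    Submodule.span ℝ {x | x ∈ P ∧ inner ℝ v x = 0} = (Submodule.span ℝ {v})ᗮ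

/-- The reflection in the hyperplane orthogonal to `v`. -/
noncomputable def refl {n : ℕ} (v : E n) : Isom n := (Submodule.span ℝ {v})ᗮ.reflection

/-- The group `G_P` generated by the reflections in the facets of `P`. -/
noncomputable def reflectionGroup {n : ℕ} (P : Set (E n)) : Subgroup (Isom n) :=
  Subgroup.closure {g | ∃ v, IsFacetNormal P v ∧ g = refl v}

/-! ### Families -/

/-- The `2^n` simplices into which the hyperplanes orthogonal to `f 1, …, f n` cut the sphere. -/
def simplicesOf {n : ℕ} (f : Fin n → E n) : Set (Set (E n)) :=
  {P | ∃ ε : Fin n → ℝ, (∀ i, ε i = 1 ∨ ε i = -1) ∧ P = simplex (fun i => ε i • f i)}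

/-- A family: the set of the `2^n` simplices cut out by the facet hyperplanes of a spherical
simplex in `S^(n-1)`. -/
structure Family (n : ℕ) where
  simplices : Set (Set (E n))
  exists_normals : ∃ f : Fin n → E n, IsNormalSystem f ∧ simplices = simplicesOf f

/-- The vectors `±f_1, …, ±f_n` of a family: the facet normals of its simplices. -/
def Family.normals {n : ℕ} (Φ : Family n) : Set (E n) :=
  {v | ∃ P ∈ Φ.simplices, IsFacetNormal P v}

/-- The image of the family `Φ` under the isometry `U` is the family `Ψ`. -/
def Family.MapsTo {n : ℕ} (U : Isom n) (Φ Ψ : Family n) : Prop :=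
  (fun P : Set (E n) => U '' P) '' Φ.simplices = Ψ.simplices

/-- Two families are the same up to an isometry of the sphere. -/
def Family.Isometric {n : ℕ} (Φ Ψ : Family n) : Prop := ∃ U : Isom n, Family.MapsTo U Φ Ψ

/-- The family `Φ` generates the group `G`: each of its simplices does. -/
def Family.Generates {n : ℕ} (Φ : Family n) (G : Subgroup (Isom n)) : Prop :=
  ∀ P ∈ Φ.simplices, reflectionGroup P = G

/-- The family `Φ` generates the reflection group `G` up to an isometry of the sphere, i.e. it
generates a conjugate of `G` in the orthogonal group. -/
def Family.GeneratesCopy {n : ℕ} (Φ : Family n) (G : Subgroup (Isom n)) : Prop :=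
  ∃ U : Isom n, Φ.Generates (G.map (MulAut.conj U).toMonoidHom)

/-! ### The reflection groups `B_n` and `D_n` -/

/-- The standard basis vector `h_i`. -/
noncomputable def h {n : ℕ} (i : Fin n) : E n := EuclideanSpace.single i (1 : ℝ)

/-- The root system `Δ(D_n) = {±h_i ± h_j : i < j}`. -/
def rootsD (n : ℕ) : Set (E n) :=
  {v | ∃ i j : Fin n, i < j ∧
    (v = h i + h j ∨ v = h i - h j ∨ v = -(h i) + h j ∨ v = -(h i) - h j)}

/-- The root system `Δ(B_n) = {±h_i, ±h_i ± h_j : i < j}`. -/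
def rootsB (n : ℕ) : Set (E n) :=
  {v | ∃ i : Fin n, v = h i ∨ v = -(h i)} ∪ rootsD n

/-- The reflection group `B_n`: the Weyl group of `Δ(B_n)`. -/
noncomputable def weylB (n : ℕ) : Subgroup (Isom n) := Subgroup.closure {g | ∃ v ∈ rootsB n, g = refl v}

/-- The reflection group `D_n`: the Weyl group of `Δ(D_n)`. -/
noncomputable def weylD (n : ℕ) : Subgroup (Isom n) := Subgroup.closure {g | ∃ v ∈ rootsD n, g = refl v}

/-- A reflection group: it is generated by the reflections that it contains. -/
def IsReflectionGroup {n : ℕ} (R : Subgroup (Isom n)) : Prop :=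
  R = Subgroup.closure {g | g ∈ R ∧ ∃ v : E n, v ≠ 0 ∧ g = refl v}

/-- A group of maximal rank: it fixes only the origin. -/
def IsMaximalRank {n : ℕ} (R : Subgroup (Isom n)) : Prop :=
  ∀ x : E n, (∀ g ∈ R, g x = x) → x = 0

/-- `Φ` is embedded into `B_n`: suitably normalized, all of its normals belong to `Δ(B_n)`. -/
def Family.IsEmbedded {n : ℕ} (Φ : Family n) : Prop :=
  ∀ v ∈ Φ.normals, ∃ c : ℝ, c • v ∈ rootsB n

/-- Some multiple of `v` is a normal of `Φ` (so that `-v` is one as well). -/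
def Family.HasNormal {n : ℕ} (Φ : Family n) (v : E n) : Prop := ∃ c : ℝ, c • v ∈ Φ.normals

/-! ### Marked graphs -/

/-- A loopless graph on `n` vertices, possibly with multiple edges, with a set of marked
vertices; `mult i j` is the number of edges that join `i` and `j`. -/
structure MarkedGraph (n : ℕ) where
  mult : Fin n → Fin n → ℕ
  symm : ∀ i j, mult i j = mult j i
  loopless : ∀ i, mult i i = 0
  marked : Set (Fin n)

/-- The simple graph in which two vertices are adjacent if at least one edge joins them. -/
def MarkedGraph.toSimpleGraph {n : ℕ} (S : MarkedGraph n) : SimpleGraph (Fin n) where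
  Adj i j := S.mult i j ≠ 0
  symm := ⟨fun i j hij => by rwa [S.symm j i]⟩
  loopless := ⟨fun i hi => hi (S.loopless i)⟩

/-- A tree with exactly one marked vertex. -/
def MarkedGraph.IsMarkedTree {n : ℕ} (S : MarkedGraph n) : Prop :=
  (∀ i j, S.mult i j ≤ 1) ∧ S.toSimpleGraph.IsTree ∧ ∃! i, i ∈ S.marked

/-- Isomorphism of marked graphs. -/
def MarkedGraph.Iso {n : ℕ} (S T : MarkedGraph n) : Prop :=
  ∃ σ : Equiv.Perm (Fin n), (∀ i j, T.mult (σ i) (σ j) = S.mult i j) ∧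
    ∀ i, σ i ∈ T.marked ↔ i ∈ S.marked

open Classical in
/-- The graph of an (embedded) family: `i` and `j` are joined by one edge if exactly one of
`±(h_i + h_j)`, `±(h_i - h_j)` is a normal of the family up to scaling, and by two edges if both
are; `i` is marked if `±h_i` is a normal. -/
noncomputable def Family.graph {n : ℕ} (Φ : Family n) : MarkedGraph n where
  mult i j := if i = j then 0 else
    (if Φ.HasNormal (h i + h j) then 1 else 0) + (if Φ.HasNormal (h i - h j) then 1 else 0)
  symm i j := by
    have key : ∀ v w : E n, w = -v → Φ.HasNormal v → Φ.HasNormal w := by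
      rintro v w rfl ⟨c, hc⟩
      exact ⟨-c, by simpa using hc⟩
    have h1 : Φ.HasNormal (h i - h j) ↔ Φ.HasNormal (h j - h i) :=
      ⟨key _ _ (by simp), key _ _ (by simp)⟩
    simp only [h1, add_comm (h i) (h j), eq_comm (a := i) (b := j)]
  loopless i := by simp
  marked := {i | Φ.HasNormal (h i)}

/-! ### Isometry classes of families and isomorphism classes of marked trees -/

/-- Families generating `B_n`. -/
abbrev BFamily (n : ℕ) : Type := {Φ : Family n // Φ.GeneratesCopy (weylB n)}

/-- Trees on `n` vertices with exactly one marked vertex. -/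
abbrev MarkedTree (n : ℕ) : Type := {S : MarkedGraph n // S.IsMarkedTree}

/-- Families generating `B_n` are identified if they are isometric. -/
instance familySetoid (n : ℕ) : Setoid (BFamily n) where
  r Φ Ψ := Family.Isometric Φ.1 Ψ.1
  iseqv := {
    refl := fun Φ => ⟨LinearIsometryEquiv.refl ℝ (E n), by simp [Family.MapsTo]⟩
    symm := by
      rintro Φ Ψ ⟨U, hU⟩
      refine ⟨U.symm, ?_⟩
      unfold Family.MapsTo at *
      rw [← hU, Set.image_image]
      simp [Set.image_image]
    trans := by
      rintro Φ Ψ Θ ⟨U, hU⟩ ⟨V, hV⟩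
      refine ⟨U.trans V, ?_⟩
      unfold Family.MapsTo at *
      rw [← hV, ← hU, Set.image_image]
      simp [Set.image_image] }

/-- Marked trees are identified if they are isomorphic. -/
instance markedTreeSetoid (n : ℕ) : Setoid (MarkedTree n) where
  r S T := MarkedGraph.Iso S.1 T.1
  iseqv := {
    refl := fun S => ⟨1, by simp, by simp⟩
    symm := by
      rintro S T ⟨σ, h1, h2⟩
      exact ⟨σ.symm, fun i j => by simp [← h1], fun i => by simp [← h2]⟩
    trans := by
      rintro S T R ⟨σ, h1, h2⟩ ⟨τ, h3, h4⟩
      exact ⟨σ.trans τ, fun i j => by simp [h1, h3], fun i => by simp [h2, h4]⟩ }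

end SphericalFamilies

/-! The group `weylB n` consists exactly of the signed permutations of the `h i` (`mem_weylB_iff`).
Hence it is finite, and every reflection in it is the reflection of a root
(`isRootLine_of_refl_mem`). Conjugating a copy of `B_n` back to `weylB n` therefore carries the
normals of a generating family to root lines. An embedded family always generates a subgroup of
`weylB n`, so generating a conjugate of it already means, by order, generating all of it.

For an embedded family that generates, two invariants bound the graph from below. The sum of squared
coordinates over a connected component would be preserved if the graph were disconnected, and
without a marked vertex the group would lie in `weylD n`, which preserves the product of the
coordinates. Linear independence bounds it from above: one marked vertex and a connected graph
already span, so a double edge, a cycle or a second mark would make some normal redundant.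
Conversely, conjugation along the edges of a marked tree produces all root reflections
(`weylB_le_of_connected`).

For `3 ≤ n`, an isometry between two embedded generating families normalizes `weylB n`, hence
permutes the root lines, and the angles between these force it to be a signed permutation
(`isSignedPerm_of_preserves`). For `n = 2` the rotation by π/4 exchanges short and long roots, but
there is only one marked tree. In the other direction a graph isomorphism lifts to a signed
permutation, because signs on the edges of a tree are a coboundary
(`SimpleGraph.IsTree.exists_potential`). Every marked tree is realized by `h m` and the normalized
`h i - h j` along its edges. Proper subgroups are excluded by comparing orders. -/

namespace SphericalFamilies

variable {n : ℕ}

/-! ### Reflections -/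

lemma refl_apply (v x : E n) : refl v x = x - (2 * (inner ℝ v x / ‖v‖ ^ 2)) • v := by
  rw [refl, Submodule.reflection_orthogonal_apply, Submodule.reflection_singleton_apply]
  simp [mul_smul, two_smul]

lemma refl_smul {c : ℝ} (hc : c ≠ 0) (v : E n) : refl (c • v) = refl v := by
  have : Submodule.span ℝ {c • v} = Submodule.span ℝ {v} :=
    Submodule.span_singleton_smul_eq (IsUnit.mk0 c hc) v
  simp only [refl, this]

lemma refl_neg (v : E n) : refl (-v) = refl v := by
  simpa using refl_smul (n := n) (c := -1) (by norm_num) v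

lemma refl_map (U : Isom n) (v : E n) : refl (U v) = U * refl v * U⁻¹ := by
  ext1 x
  have h1 : inner ℝ (U v) x = inner ℝ v (U.symm x) := by
    rw [← U.inner_map_map v (U.symm x), U.apply_symm_apply]
  have h2 : (U * refl v * U⁻¹) x = U (refl v (U.symm x)) := rfl
  rw [h2, refl_apply, refl_apply]
  simp [h1]

lemma refl_mul_self (v : E n) : refl v * refl v = 1 :=
  Submodule.reflection_mul_reflection _

lemma refl_of_inner_eq_zero {v x : E n} (hv : inner ℝ v x = 0) : refl v x = x := by
  simp [refl_apply, hv]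

/-! ### Facets of spherical simplices -/

/-- The value `-1` puts each `g j` into the cone on the nonpositive side of all `f i`: normalized,
the `g j` are the vertices of the simplex. -/
lemma exists_dual {f : Fin n → E n} (hf : LinearIndependent ℝ f) :
    ∃ g : Fin n → E n, ∀ i j, inner ℝ (f i) (g j) = if i = j then -1 else 0 := by
  let T : E n →ₗ[ℝ] (Fin n → ℝ) := LinearMap.pi fun i => (innerSL ℝ (f i)).toLinearMap
  have hspan : Submodule.span ℝ (Set.range f) = ⊤ :=
    hf.span_eq_top_of_card_eq_finrank' (by simp)
  have hT : Function.Injective T := by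
    rw [← LinearMap.ker_eq_bot, LinearMap.ker_eq_bot']
    intro x hx
    have h1 : ∀ y ∈ Submodule.span ℝ (Set.range f), inner ℝ y x = 0 := by
      intro y hy
      induction hy using Submodule.span_induction with
      | mem y hy =>
        obtain ⟨i, rfl⟩ := hy
        exact congrFun hx i
      | zero => simp
      | add y z _ _ hy hz => simp [inner_add_left, hy, hz]
      | smul c y _ hy => simp [inner_smul_left, hy]
    exact inner_self_eq_zero.1 (h1 x (by simp [hspan]))
  have hT' : Function.Surjective T :=
    (LinearMap.injective_iff_surjective_of_finrank_eq_finrank (by simp)).1 hT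
  choose g hg using fun j : Fin n => hT' fun i => if i = j then (-1 : ℝ) else 0
  exact ⟨g, fun i j => congrFun (hg j) i⟩

lemma eq_sum_of_dual {f g : Fin n → E n} (hf : LinearIndependent ℝ f)
    (hg : ∀ i j, inner ℝ (f i) (g j) = if i = j then (-1 : ℝ) else 0) (v : E n) :
    v = ∑ i, (-inner ℝ v (g i)) • f i := by
  have hspan : Submodule.span ℝ (Set.range f) = ⊤ :=
    hf.span_eq_top_of_card_eq_finrank' (by simp)
  have hv : v ∈ Submodule.span ℝ (Set.range f) := by simp [hspan]
  obtain ⟨c, rfl⟩ := (Submodule.mem_span_range_iff_exists_fun ℝ).1 hv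
  simp [sum_inner, inner_smul_left, hg]

lemma eq_sum_dual {f g : Fin n → E n} (hf : LinearIndependent ℝ f)
    (hg : ∀ i j, inner ℝ (f i) (g j) = if i = j then (-1 : ℝ) else 0) (x : E n) :
    x = ∑ i, (-inner ℝ (f i) x) • g i := by
  refine ext_inner_left ℝ fun v => ?_
  conv_lhs => rw [eq_sum_of_dual hf hg v]
  simp [sum_inner, inner_sum, inner_smul_left, inner_smul_right, mul_comm]

/-- The face orthogonal to `f i` contains the vertices `g j` with `j ≠ i`, normalized, and these
span the hyperplane. -/
lemma IsNormalSystem.facet {f : Fin n → E n} (hf : IsNormalSystem f) (i : Fin n) :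
    IsFacetNormal (simplex f) (f i) := by
  obtain ⟨g, hg⟩ := exists_dual hf.2
  refine ⟨hf.1 i, fun x hx => hx.2 i, le_antisymm ?_ fun x hx => ?_⟩
  · rw [Submodule.span_le]
    rintro x ⟨-, hx⟩
    exact Submodule.mem_orthogonal_singleton_iff_inner_right.2 hx
  · rw [Submodule.mem_orthogonal_singleton_iff_inner_right] at hx
    rw [eq_sum_dual hf.2 hg x]
    refine Submodule.sum_mem _ fun j _ => ?_
    rcases eq_or_ne i j with rfl | hij
    · simp [hx]
    · have hgj : g j ≠ 0 := by
        intro h0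
        have := hg j j
        simp [h0] at this
      have hpos : 0 < ‖g j‖ := norm_pos_iff.2 hgj
      have hmem : ‖g j‖⁻¹ • g j ∈ {x | x ∈ simplex f ∧ inner ℝ (f i) x = 0} := by
        refine ⟨⟨by simp [norm_smul, hpos.ne'], fun k => ?_⟩, ?_⟩
        · rw [inner_smul_right, hg]
          split_ifs
          · have := inv_pos.2 hpos
            linarith
          · simp
        · simp [inner_smul_right, hg, hij]
      have := Submodule.smul_mem _ ‖g j‖ (Submodule.subset_span (R := ℝ) hmem)
      rw [smul_smul, mul_inv_cancel₀ hpos.ne', one_smul] at this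
      exact Submodule.smul_mem _ _ this

/-- Testing on the vertices shows that `v` is a nonnegative combination of the `f i`. On its face
every term of the combination vanishes, so an `f j` with positive coefficient is orthogonal to the
whole face and must be proportional to `v`. -/
lemma IsNormalSystem.exists_eq_of_facet {f : Fin n → E n} (hf : IsNormalSystem f) {v : E n}
    (hv : IsFacetNormal (simplex f) v) : ∃ i, v = f i := by
  obtain ⟨g, hg⟩ := exists_dual hf.2
  obtain ⟨hv1, hv2, hv3⟩ := hv
  have ha : ∀ j, 0 ≤ -inner ℝ v (g j) := by
    intro j
    have hgj : g j ≠ 0 := by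
      intro h0
      have := hg j j
      simp [h0] at this
    have hpos : 0 < ‖g j‖ := norm_pos_iff.2 hgj
    have := hv2 (‖g j‖⁻¹ • g j) ⟨by simp [norm_smul, hpos.ne'], fun k => by
      rw [inner_smul_right, hg]
      split_ifs
      · have := inv_pos.2 hpos
        linarith
      · simp⟩
    rw [inner_smul_right] at this
    have := nonpos_of_mul_nonpos_right this (inv_pos.2 hpos)
    linarith
  have hsum := eq_sum_of_dual hf.2 hg v
  obtain ⟨j, hj⟩ : ∃ j, inner ℝ v (g j) ≠ 0 := by
    by_contra! hcon
    have : v = 0 := by rw [hsum]; simp [hcon]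
    simp [this] at hv1
  have hj' : 0 < -inner ℝ v (g j) := lt_of_le_of_ne (ha j) fun h0 => hj (by linarith)
  have hfj : f j ∈ Submodule.span ℝ {v} := by
    rw [← Submodule.orthogonal_orthogonal (Submodule.span ℝ {v}), ← hv3, Submodule.mem_orthogonal]
    intro x hx
    induction hx using Submodule.span_induction with
    | zero => simp
    | add y z _ _ hy hz => simp [inner_add_left, hy, hz]
    | smul c y _ hy => simp [inner_smul_left, hy]
    | mem x hx =>
      have h0 : ∑ i, (-inner ℝ v (g i)) * inner ℝ (f i) x = 0 := by
        rw [← hx.2]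
        conv_rhs => rw [hsum]
        simp [sum_inner, inner_smul_left]
      have h1 := (Finset.sum_eq_zero_iff_of_nonpos fun i _ =>
        mul_nonpos_of_nonneg_of_nonpos (ha i) (hx.1.2 i)).1 h0 j (Finset.mem_univ j)
      rw [real_inner_comm]
      exact (mul_eq_zero.1 h1).resolve_left hj'.ne'
  obtain ⟨c, hc⟩ := Submodule.mem_span_singleton.1 hfj
  have hcc : |c| = 1 := by
    have := hf.1 j
    rwa [← hc, norm_smul, hv1, mul_one, Real.norm_eq_abs] at this
  -- `c` times the negative number `inner ℝ v (g j)` equals `-1`.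
  have hcpos : 0 < c := by
    have := hg j j
    rw [← hc, inner_smul_left] at this
    simp only [RCLike.conj_to_real, if_true] at this
    by_contra! hneg
    nlinarith
  rw [abs_of_pos hcpos] at hcc
  exact ⟨j, by rw [← hc, hcc, one_smul]⟩

lemma IsNormalSystem.facet_iff {f : Fin n → E n} (hf : IsNormalSystem f) {v : E n} :
    IsFacetNormal (simplex f) v ↔ ∃ i, v = f i :=
  ⟨hf.exists_eq_of_facet, fun ⟨i, hi⟩ => hi ▸ hf.facet i⟩

lemma IsNormalSystem.smul {f : Fin n → E n} (hf : IsNormalSystem f) {ε : Fin n → ℝ}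
    (hε : ∀ i, ε i = 1 ∨ ε i = -1) : IsNormalSystem fun i => ε i • f i := by
  refine ⟨fun i => ?_, ?_⟩
  · rcases hε i with h | h <;> simp [h, hf.1 i]
  · have h0 : ∀ i, ε i ≠ 0 := fun i => by rcases hε i with h | h <;> simp [h]
    exact hf.2.units_smul fun i => Units.mk0 (ε i) (h0 i)

lemma IsNormalSystem.map {f : Fin n → E n} (hf : IsNormalSystem f) (U : Isom n) :
    IsNormalSystem fun i => U (f i) :=
  ⟨fun i => by simp [hf.1 i], hf.2.map' U.toLinearEquiv.toLinearMap (LinearEquiv.ker _)⟩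

/-! ### Normals and reflection groups of families -/

/-- The family whose facet hyperplanes are orthogonal to the vectors of a normal system. -/
def IsNormalSystem.family {f : Fin n → E n} (hf : IsNormalSystem f) : Family n where
  simplices := simplicesOf f
  exists_normals := ⟨f, hf, rfl⟩

/-- `f` is a system of normals of the family `Φ`, one for each pair of opposite ones. -/
def Family.HasSystem (Φ : Family n) (f : Fin n → E n) : Prop :=
  IsNormalSystem f ∧ Φ.simplices = simplicesOf f

lemma Family.exists_system (Φ : Family n) : ∃ f, Φ.HasSystem f := Φ.exists_normals

lemma Family.HasSystem.mem_normals {Φ : Family n} {f : Fin n → E n} (hf : Φ.HasSystem f)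
    {v : E n} : v ∈ Φ.normals ↔ ∃ i, v = f i ∨ v = -f i := by
  constructor
  · rintro ⟨P, hP, hv⟩
    rw [hf.2] at hP
    obtain ⟨ε, hε, rfl⟩ := hP
    obtain ⟨i, rfl⟩ := (hf.1.smul hε).facet_iff.1 hv
    refine ⟨i, ?_⟩
    rcases hε i with h | h <;> simp [h]
  · rintro ⟨i, hi⟩
    obtain ⟨s, hs, rfl⟩ : ∃ s : ℝ, (s = 1 ∨ s = -1) ∧ v = s • f i := by
      rcases hi with rfl | rfl
      · exact ⟨1, by simp⟩
      · exact ⟨-1, by simp⟩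
    refine ⟨simplex fun j => s • f j, ?_, (hf.1.smul fun _ => hs).facet i⟩
    rw [hf.2]
    exact ⟨fun _ => s, fun _ => hs, rfl⟩

lemma Family.HasSystem.hasNormal_iff {Φ : Family n} {f : Fin n → E n} (hf : Φ.HasSystem f)
    {v : E n} : Φ.HasNormal v ↔ ∃ i, ∃ c : ℝ, c • v = f i := by
  constructor
  · rintro ⟨c, hc⟩
    obtain ⟨i, hi | hi⟩ := hf.mem_normals.1 hc
    · exact ⟨i, c, hi⟩
    · exact ⟨i, -c, by simp [hi]⟩
  · rintro ⟨i, c, hc⟩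
    exact ⟨c, hf.mem_normals.2 ⟨i, Or.inl hc⟩⟩

lemma reflectionGroup_simplex {f : Fin n → E n} (hf : IsNormalSystem f) :
    reflectionGroup (simplex f) = Subgroup.closure (Set.range fun i => refl (f i)) := by
  unfold reflectionGroup
  congr 1
  ext g
  constructor
  · rintro ⟨v, hv, rfl⟩
    obtain ⟨i, rfl⟩ := hf.facet_iff.1 hv
    exact ⟨i, rfl⟩
  · rintro ⟨i, rfl⟩
    exact ⟨f i, hf.facet i, rfl⟩

lemma Family.HasSystem.generates_iff {Φ : Family n} {f : Fin n → E n} (hf : Φ.HasSystem f)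
    {G : Subgroup (Isom n)} :
    Φ.Generates G ↔ Subgroup.closure (Set.range fun i => refl (f i)) = G := by
  have key : ∀ ε : Fin n → ℝ, (∀ i, ε i = 1 ∨ ε i = -1) →
      reflectionGroup (simplex fun i => ε i • f i) =
        Subgroup.closure (Set.range fun i => refl (f i)) := by
    intro ε hε
    rw [reflectionGroup_simplex (hf.1.smul hε)]
    congr 2
    funext i
    exact refl_smul (by rcases hε i with h | h <;> simp [h]) _
  constructor
  · intro h
    rw [← key (fun _ => 1) (by simp)]
    exact h _ (by rw [hf.2]; exact ⟨fun _ => 1, by simp, rfl⟩)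
  · intro h P hP
    rw [hf.2] at hP
    obtain ⟨ε, hε, rfl⟩ := hP
    rw [key ε hε, h]

lemma image_simplex (U : Isom n) (f : Fin n → E n) :
    U '' simplex f = simplex fun i => U (f i) := by
  ext x
  constructor
  · rintro ⟨y, hy, rfl⟩
    exact ⟨by simp [hy.1], fun i => by simpa using hy.2 i⟩
  · rintro ⟨h1, h2⟩
    refine ⟨U.symm x, ⟨by simp [h1], fun i => ?_⟩, by simp⟩
    rw [← U.inner_map_map, U.apply_symm_apply]
    exact h2 i

lemma image_simplicesOf (U : Isom n) (f : Fin n → E n) :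
    (fun P : Set (E n) => U '' P) '' simplicesOf f = simplicesOf fun i => U (f i) := by
  ext P
  constructor
  · rintro ⟨Q, ⟨ε, hε, rfl⟩, rfl⟩
    exact ⟨ε, hε, by simp [image_simplex]⟩
  · rintro ⟨ε, hε, rfl⟩
    exact ⟨_, ⟨ε, hε, rfl⟩, by simp [image_simplex]⟩

/-- Independence of `f'` makes the matching of indices injective, hence a permutation; the signs are
absorbed into `ε`. -/
lemma simplicesOf_congr {f f' : Fin n → E n} (hf' : IsNormalSystem f')
    (hff : ∀ j, ∃ i, f' j = f i ∨ f' j = -f i) : simplicesOf f' = simplicesOf f := by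
  have hs : ∀ j, ∃ i, ∃ s : ℝ, (s = 1 ∨ s = -1) ∧ f' j = s • f i := by
    intro j
    obtain ⟨i, h | h⟩ := hff j
    · exact ⟨i, 1, by simp, by simp [h]⟩
    · exact ⟨i, -1, by simp, by simp [h]⟩
  choose τ s hs1 hs2 using hs
  have hss : ∀ j, s j * s j = 1 := fun j => by rcases hs1 j with h | h <;> simp [h]
  have hinj : Function.Injective τ := by
    intro j k hjk
    by_contra hne
    have h1 : f' j = (s j * s k) • f' k := by
      rw [hs2 j, hs2 k, hjk, smul_smul, mul_assoc, hss, mul_one]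
    have h2 := hf'.2.notMem_span_image (s := {k}) (x := j) (by simpa using hne)
    apply h2
    rw [Set.image_singleton, h1]
    exact Submodule.smul_mem _ _ (Submodule.mem_span_singleton_self _)
  let e : Fin n ≃ Fin n := Equiv.ofBijective τ ⟨hinj, Finite.injective_iff_surjective.1 hinj⟩
  have he : ∀ j, e j = τ j := fun _ => rfl
  ext P
  constructor
  · rintro ⟨ε, hε, rfl⟩
    refine ⟨fun i => ε (e.symm i) * s (e.symm i), fun i => ?_, ?_⟩
    · rcases hε (e.symm i) with h | h <;> rcases hs1 (e.symm i) with h' | h' <;> simp [h, h']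
    · ext x
      refine and_congr_right fun _ => ⟨fun hx i => ?_, fun hx j => ?_⟩
      · have := hx (e.symm i)
        simpa [hs2, ← he, smul_smul] using this
      · have := hx (e j)
        simpa [hs2, ← he, smul_smul] using this
  · rintro ⟨ε, hε, rfl⟩
    refine ⟨fun j => ε (τ j) * s j, fun j => ?_, ?_⟩
    · rcases hε (τ j) with h | h <;> rcases hs1 j with h' | h' <;> simp [h, h']
    · have h3 : ∀ j, (ε (τ j) * s j) • f' j = ε (τ j) • f (τ j) := fun j => by
        rw [hs2 j, smul_smul, mul_assoc, hss, mul_one]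
      ext x
      refine and_congr_right fun _ => ⟨fun hx j => ?_, fun hx i => ?_⟩
      · simpa only [h3] using hx (τ j)
      · have := hx (e.symm i)
        simp only [h3] at this
        rwa [← he, e.apply_symm_apply] at this

lemma Family.mapsTo_iff {Φ Ψ : Family n} {f f' : Fin n → E n} (hf : Φ.HasSystem f)
    (hf' : Ψ.HasSystem f') (U : Isom n) :
    Family.MapsTo U Φ Ψ ↔ ∀ i, ∃ j, U (f i) = f' j ∨ U (f i) = -f' j := by
  constructor
  · intro h i
    have : U (f i) ∈ Ψ.normals := by
      refine ⟨simplex fun i => U (f i), ?_, (hf.1.map U).facet i⟩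
      rw [← h, hf.2, image_simplicesOf]
      exact ⟨fun _ => 1, by simp, by simp⟩
    exact hf'.mem_normals.1 this
  · intro h
    unfold Family.MapsTo
    rw [hf.2, hf'.2, image_simplicesOf]
    exact simplicesOf_congr (hf.1.map U) h

lemma refl_sub_apply {v w : E n} (hvw : ‖v‖ = ‖w‖) : refl (v - w) w = v := by
  have h1 : refl (v - w) v = w := Submodule.reflection_sub hvw
  have h2 : refl (v - w) (refl (v - w) v) = v := Submodule.reflection_reflection _ _
  rwa [h1] at h2

/-! ### Roots and their reflections -/

lemma h_apply (i k : Fin n) : (h i : E n) k = if k = i then 1 else 0 := by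
  simp [h]

@[simp] lemma inner_h (i : Fin n) (x : E n) : inner ℝ (h i) x = x i := by
  simp [h, EuclideanSpace.inner_single_left]

@[simp] lemma norm_h (i : Fin n) : ‖(h i : E n)‖ = 1 := by simp [h]

lemma h_ne_zero (i : Fin n) : (h i : E n) ≠ 0 := by
  intro h0
  have := norm_h i
  simp [h0] at this

lemma h_eq_or_neg {i j : Fin n} (hij : h i = h j ∨ h i = -(h j : E n)) : i = j := by
  by_contra hne
  rcases hij with hij | hij <;>
  · have := congrArg (fun x : E n => x i) hij
    simp [h_apply, hne] at this

lemma edge_ne_zero {i j : Fin n} (hij : i ≠ j) (s : ℝ) : (h i + s • h j : E n) ≠ 0 := by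
  intro h0
  have := congrArg (fun x : E n => x i) h0
  simp [h_apply, hij] at this

lemma norm_edge_sq {i j : Fin n} (hij : i ≠ j) {s : ℝ} (hs : s = 1 ∨ s = -1) :
    ‖(h i + s • h j : E n)‖ ^ 2 = 2 := by
  rw [← real_inner_self_eq_norm_sq, inner_add_left, inner_smul_left, inner_h, inner_h]
  rcases hs with rfl | rfl <;>
  · simp [h_apply, hij, hij.symm]
    norm_num

lemma refl_h_apply (i : Fin n) (x : E n) (k : Fin n) :
    refl (h i) x k = if k = i then -x i else x k := by
  rw [refl_apply]
  by_cases hk : k = i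
  · subst hk; simp [h_apply]; ring
  · simp [h_apply, hk]

lemma refl_edge_apply {i j : Fin n} (hij : i ≠ j) {s : ℝ} (hs : s = 1 ∨ s = -1) (x : E n)
    (k : Fin n) : refl (h i + s • h j) x k =
      if k = i then -s * x j else if k = j then -s * x i else x k := by
  rw [refl_apply, norm_edge_sq hij hs]
  by_cases hk : k = i
  · subst hk; simp [h_apply, hij, inner_add_left, inner_smul_left]; ring
  · by_cases hk' : k = j
    · subst hk'; simp [h_apply, hk, inner_add_left, inner_smul_left]
      rcases hs with rfl | rfl <;> ring
    · simp [h_apply, hk, hk']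

/-- `v` spans the same line as a root of `Δ(B_n)`. -/
def IsRootLine (v : E n) : Prop :=
  (∃ i : Fin n, ∃ a : ℝ, a ≠ 0 ∧ v = a • h i) ∨
    ∃ (i j : Fin n) (s a : ℝ), i ≠ j ∧ (s = 1 ∨ s = -1) ∧ a ≠ 0 ∧ v = a • (h i + s • h j)

lemma isRootLine_h (i : Fin n) : IsRootLine (h i) := Or.inl ⟨i, 1, one_ne_zero, by simp⟩

lemma isRootLine_edge {i j : Fin n} (hij : i ≠ j) {s : ℝ} (hs : s = 1 ∨ s = -1) :
    IsRootLine (h i + s • h j) := Or.inr ⟨i, j, s, 1, hij, hs, one_ne_zero, by simp⟩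

lemma IsRootLine.smul {v : E n} (hv : IsRootLine v) {c : ℝ} (hc : c ≠ 0) :
    IsRootLine (c • v) := by
  rcases hv with ⟨i, a, ha, rfl⟩ | ⟨i, j, s, a, hij, hs, ha, rfl⟩
  · exact Or.inl ⟨i, c * a, mul_ne_zero hc ha, by rw [smul_smul]⟩
  · exact Or.inr ⟨i, j, s, c * a, hij, hs, mul_ne_zero hc ha, by rw [smul_smul]⟩

lemma isRootLine_smul_iff {v : E n} {c : ℝ} (hc : c ≠ 0) :
    IsRootLine (c • v) ↔ IsRootLine v :=
  ⟨fun hv => by simpa [smul_smul, hc] using hv.smul (inv_ne_zero hc), fun hv => hv.smul hc⟩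

lemma edge_mem_rootsD {i j : Fin n} (hij : i ≠ j) {s : ℝ} (hs : s = 1 ∨ s = -1) :
    h i + s • h j ∈ rootsD n := by
  rcases lt_or_gt_of_ne hij with hlt | hlt
  · refine ⟨i, j, hlt, ?_⟩
    rcases hs with rfl | rfl
    · left; simp
    · right; left; simp [sub_eq_add_neg]
  · refine ⟨j, i, hlt, ?_⟩
    rcases hs with rfl | rfl
    · left; simp [add_comm]
    · right; right; left; simp [add_comm]

lemma exists_edge_of_mem_rootsD {v : E n} (hv : v ∈ rootsD n) :
    ∃ (i j : Fin n) (s a : ℝ), i ≠ j ∧ (s = 1 ∨ s = -1) ∧ a ≠ 0 ∧ v = a • (h i + s • h j) := by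
  obtain ⟨i, j, hij, rfl | rfl | rfl | rfl⟩ := hv
  · exact ⟨i, j, 1, 1, hij.ne, by simp, by simp, by simp⟩
  · exact ⟨i, j, -1, 1, hij.ne, by simp, by simp, by simp [sub_eq_add_neg]⟩
  · exact ⟨i, j, -1, -1, hij.ne, by simp, by simp, by simp⟩
  · exact ⟨i, j, 1, -1, hij.ne, by simp, by simp, by simp [sub_eq_add_neg]⟩

lemma isRootLine_of_mem_rootsB {v : E n} (hv : v ∈ rootsB n) : IsRootLine v := by
  rcases hv with ⟨i, rfl | rfl⟩ | hv
  · exact isRootLine_h i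
  · exact Or.inl ⟨i, -1, by simp, by simp⟩
  · exact Or.inr (exists_edge_of_mem_rootsD hv)

lemma IsRootLine.exists_smul_mem {v : E n} (hv : IsRootLine v) : ∃ c : ℝ, c • v ∈ rootsB n := by
  rcases hv with ⟨i, a, ha, rfl⟩ | ⟨i, j, s, a, hij, hs, ha, rfl⟩
  · exact ⟨a⁻¹, Or.inl ⟨i, by simp [smul_smul, ha]⟩⟩
  · refine ⟨a⁻¹, Or.inr ?_⟩
    rw [smul_smul, inv_mul_cancel₀ ha, one_smul]
    exact edge_mem_rootsD hij hs

lemma zero_notMem_rootsB : (0 : E n) ∉ rootsB n := by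
  intro h0
  rcases isRootLine_of_mem_rootsB h0 with ⟨i, a, ha, h1⟩ | ⟨i, j, s, a, hij, hs, ha, h1⟩
  · exact (smul_ne_zero ha (h_ne_zero i)) h1.symm
  · exact (smul_ne_zero ha (edge_ne_zero hij s)) h1.symm

lemma IsRootLine.ne_zero {v : E n} (hv : IsRootLine v) : v ≠ 0 := by
  rintro rfl
  obtain ⟨c, hc⟩ := hv.exists_smul_mem
  exact zero_notMem_rootsB (by simpa using hc)

lemma isRootLine_of_smul_mem {v : E n} {c : ℝ} (hc : c • v ∈ rootsB n) : IsRootLine v := by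
  have hc0 : c ≠ 0 := by
    rintro rfl
    exact zero_notMem_rootsB (by simpa using hc)
  exact (isRootLine_smul_iff hc0).1 (isRootLine_of_mem_rootsB hc)

lemma IsRootLine.refl_mem {v : E n} (hv : IsRootLine v) : refl v ∈ weylB n := by
  obtain ⟨c, hc⟩ := hv.exists_smul_mem
  have hc0 : c ≠ 0 := by
    rintro rfl
    exact zero_notMem_rootsB (by simpa using hc)
  exact Subgroup.subset_closure ⟨_, hc, (refl_smul hc0 v).symm⟩

lemma Family.HasSystem.isEmbedded_iff {Φ : Family n} {f : Fin n → E n} (hf : Φ.HasSystem f) :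
    Φ.IsEmbedded ↔ ∀ i, IsRootLine (f i) := by
  constructor
  · intro hΦ i
    obtain ⟨c, hc⟩ := hΦ (f i) (hf.mem_normals.2 ⟨i, Or.inl rfl⟩)
    exact isRootLine_of_smul_mem hc
  · intro hΦ v hv
    obtain ⟨i, rfl | rfl⟩ := hf.mem_normals.1 hv
    · exact (hΦ i).exists_smul_mem
    · obtain ⟨c, hc⟩ := (hΦ i).exists_smul_mem
      exact ⟨-c, by simpa using hc⟩

/-! ### Signed permutations -/

/-- `U` permutes the vectors `±h_i`. -/
def IsSignedPerm (U : Isom n) : Prop := ∀ i, ∃ j, U (h i) = h j ∨ U (h i) = -h j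

lemma IsSignedPerm.exists_perm {U : Isom n} (hU : IsSignedPerm U) :
    ∃ (σ : Equiv.Perm (Fin n)) (s : Fin n → ℝ), (∀ i, s i = 1 ∨ s i = -1) ∧
      ∀ i, U (h i) = s i • h (σ i) := by
  have hs : ∀ i, ∃ j, ∃ s : ℝ, (s = 1 ∨ s = -1) ∧ U (h i) = s • h j := by
    intro i
    obtain ⟨j, hj | hj⟩ := hU i
    · exact ⟨j, 1, by simp, by simp [hj]⟩
    · exact ⟨j, -1, by simp, by simp [hj]⟩
  choose σ s hs1 hs2 using hs
  have hinj : Function.Injective σ := by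
    intro i j hij
    have h1 : U (h i) = (s i * s j) • U (h j) := by
      rw [hs2 i, hs2 j, hij, smul_smul, mul_assoc]
      rcases hs1 j with h | h <;> simp [h]
    rw [← map_smul, U.injective.eq_iff] at h1
    apply h_eq_or_neg
    rw [h1]
    rcases hs1 i with h | h <;> rcases hs1 j with h' | h' <;> simp [h, h']
  exact ⟨Equiv.ofBijective σ ⟨hinj, Finite.injective_iff_surjective.1 hinj⟩, s, hs1, hs2⟩

lemma ext_h {U V : Isom n} (huv : ∀ i, U (h i) = V (h i)) : U = V := by
  ext1 x
  have hx : x = ∑ i, x i • h i := by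
    ext k
    simp [h_apply]
  rw [hx]
  simp [huv]

lemma IsSignedPerm.inv {U : Isom n} (hU : IsSignedPerm U) : IsSignedPerm U⁻¹ := by
  obtain ⟨σ, s, hs, h1⟩ := hU.exists_perm
  intro i
  refine ⟨σ.symm i, ?_⟩
  have h2 := h1 (σ.symm i)
  rw [σ.apply_symm_apply] at h2
  have h3 : U⁻¹ (U (h (σ.symm i))) = h (σ.symm i) := U.symm_apply_apply _
  rcases hs (σ.symm i) with h | h
  · left
    rw [h, one_smul] at h2
    rw [← h2, h3]
  · right
    rw [h, neg_smul, one_smul] at h2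
    rw [← h3, h2, map_neg, neg_neg]

lemma IsSignedPerm.mul {U V : Isom n} (hU : IsSignedPerm U) (hV : IsSignedPerm V) :
    IsSignedPerm (U * V) := by
  intro i
  obtain ⟨j, hj⟩ := hV i
  obtain ⟨k, hk⟩ := hU j
  refine ⟨k, ?_⟩
  change U (V (h i)) = _ ∨ U (V (h i)) = _
  rcases hj with hj | hj <;> rcases hk with hk | hk <;> simp [hj, hk]

lemma IsRootLine.isSignedPerm_refl {v : E n} (hv : IsRootLine v) : IsSignedPerm (refl v) := by
  intro k
  rcases hv with ⟨i, a, ha, rfl⟩ | ⟨i, j, s, a, hij, hs, ha, rfl⟩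
  · refine ⟨k, ?_⟩
    rw [refl_smul ha]
    by_cases hk : k = i
    · right; subst hk
      ext l
      rw [refl_h_apply]
      by_cases hl : l = k <;> simp [h_apply, hl]
    · left
      ext l
      rw [refl_h_apply]
      by_cases hl : l = i
      · subst hl; simp [h_apply, Ne.symm hk]
      · simp [hl]
  · refine ⟨Equiv.swap i j k, ?_⟩
    rw [refl_smul ha]
    have key : refl (h i + s • h j) (h k) =
        (if k = i ∨ k = j then -s else 1) • h (Equiv.swap i j k) := by
      ext l
      rw [refl_edge_apply hij hs]
      by_cases hk : k = i
      · subst hk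
        by_cases h1 : l = k
        · subst h1; simp [h_apply, hij, hij.symm]
        · rcases eq_or_ne l j with rfl | h2 <;> simp [h_apply, *]
      · by_cases hk' : k = j
        · subst hk'
          by_cases h1 : l = i
          · subst h1; simp [h_apply]
          · rcases eq_or_ne l k with rfl | h2 <;> simp [h_apply, *]
        · rw [Equiv.swap_apply_of_ne_of_ne hk hk']
          by_cases h1 : l = i
          · subst h1; simp [h_apply, hk, hk', Ne.symm hk, Ne.symm hk']
          · by_cases h2 : l = j
            · subst h2; simp [h_apply, h1, hk, hk', Ne.symm hk, Ne.symm hk']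
            · simp [h_apply, h1, h2, hk, hk']
    rw [key]
    split_ifs
    · rcases hs with rfl | rfl <;> simp
    · simp

/-- Induction on the number of `h i` that are moved. If `h i` is moved, `h i - U (h i)` is a root
line; its reflection returns `U (h i)` to `h i` and, by orthogonality, fixes every `h k` fixed by
`U`. -/
lemma IsSignedPerm.mem_weylB {U : Isom n} (hU : IsSignedPerm U) : U ∈ weylB n := by
  classical
  induction hc : (Finset.univ.filter fun i => U (h i) ≠ h i).card using Nat.strong_induction_on
    generalizing U with
  | _ c ih =>
    by_cases hfix : ∀ i, U (h i) = h i
    · have : U = 1 := ext_h fun i => hfix i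
      rw [this]
      exact one_mem _
    · push Not at hfix
      obtain ⟨i, hi⟩ := hfix
      have hv : IsRootLine (h i - U (h i)) := by
        obtain ⟨j, hj⟩ := hU i
        by_cases hij : i = j
        · subst hij
          have : U (h i) = -h i := hj.resolve_left hi
          rw [this]
          exact Or.inl ⟨i, 2, by norm_num, by rw [two_smul]; simp⟩
        · rcases hj with hj | hj
          · rw [hj]
            have := isRootLine_edge hij (s := -1) (by simp)
            simpa [sub_eq_add_neg] using this
          · rw [hj]
            have := isRootLine_edge hij (s := 1) (by simp)
            simpa [sub_eq_add_neg] using this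
      have hr1 : refl (h i - U (h i)) (U (h i)) = h i := refl_sub_apply (by simp)
      have hr2 : ∀ k, U (h k) = h k → refl (h i - U (h i)) (h k) = h k := by
        intro k hk
        apply refl_of_inner_eq_zero
        have hki : i ≠ k := fun hki => hi (hki ▸ hk)
        have h1 : inner ℝ (U (h i)) (h k) = (0 : ℝ) := by
          rw [← hk, U.inner_map_map]
          simp [h_apply, hki]
        rw [inner_sub_left, h1]
        simp [h_apply, hki]
      have hmem := ih _ ?_ (hv.isSignedPerm_refl.mul hU) rfl
      · have := (weylB n).mul_mem hv.refl_mem hmem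
        rwa [← mul_assoc, refl_mul_self, one_mul] at this
      · rw [← hc]
        apply Finset.card_lt_card
        rw [Finset.ssubset_iff_of_subset]
        · refine ⟨i, by simp [hi], ?_⟩
          simp only [Finset.mem_filter, Finset.mem_univ, true_and, not_not]
          exact hr1
        · intro k hk
          simp only [Finset.mem_filter, Finset.mem_univ, true_and] at hk ⊢
          intro hk'
          apply hk
          change refl (h i - U (h i)) (U (h k)) = h k
          rw [hk', hr2 k hk']

lemma mem_weylB_iff {U : Isom n} : U ∈ weylB n ↔ IsSignedPerm U := by
  refine ⟨fun hU => ?_, IsSignedPerm.mem_weylB⟩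
  induction hU using Subgroup.closure_induction with
  | mem g hg =>
    obtain ⟨v, hv, rfl⟩ := hg
    exact (isRootLine_of_mem_rootsB hv).isSignedPerm_refl
  | one => exact fun i => ⟨i, Or.inl rfl⟩
  | mul g k _ _ hg hk => exact hg.mul hk
  | inv g _ hg => exact hg.inv

/-- A reflection moves any vector along its root: if `v k ≠ 0`, then `h k - refl v (h k)` is a
nonzero multiple of `v`, and it is `h k` minus some `±h j`. -/
lemma isRootLine_of_refl_mem {v : E n} (hv : v ≠ 0) (hr : refl v ∈ weylB n) : IsRootLine v := by
  obtain ⟨k, hk⟩ : ∃ k, v k ≠ 0 := by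
    by_contra! hcon
    exact hv (by ext k; simp [hcon k])
  obtain ⟨j, hj⟩ := mem_weylB_iff.1 hr k
  have hnorm : ‖v‖ ^ 2 ≠ 0 := by simpa using hv
  have hc : 2 * (v k / ‖v‖ ^ 2) ≠ 0 := mul_ne_zero two_ne_zero (div_ne_zero hk hnorm)
  rw [← isRootLine_smul_iff hc]
  have h0 : (2 * (v k / ‖v‖ ^ 2)) • v = h k - refl v (h k) := by
    rw [refl_apply, real_inner_comm, inner_h]
    simp
  have hne : h k - refl v (h k) ≠ 0 := by
    rw [← h0]
    exact smul_ne_zero hc hv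
  rw [h0]
  by_cases hkj : k = j
  · subst hkj
    rcases hj with hj | hj
    · exact absurd (by rw [hj, sub_self]) hne
    · rw [hj]
      exact Or.inl ⟨k, 2, by norm_num, by rw [two_smul]; simp⟩
  · rcases hj with hj | hj
    · rw [hj]
      have := isRootLine_edge hkj (s := -1) (by simp)
      simpa [sub_eq_add_neg] using this
    · rw [hj]
      have := isRootLine_edge hkj (s := 1) (by simp)
      simpa [sub_eq_add_neg] using this

instance finite_weylB (n : ℕ) : Finite (weylB n) := by
  let B : Set (E n) := Set.range h ∪ Set.range fun i => -h i
  have hB : Finite B := ((Set.finite_range _).union (Set.finite_range _)).to_subtype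
  have hmem : ∀ (U : weylB n) (i : Fin n), U.1 (h i) ∈ B := by
    intro U i
    obtain ⟨j, hj | hj⟩ := mem_weylB_iff.1 U.2 i
    · exact Or.inl ⟨j, hj.symm⟩
    · exact Or.inr ⟨j, hj.symm⟩
  refine Finite.of_injective (fun (U : weylB n) (i : Fin n) => (⟨U.1 (h i), hmem U i⟩ : B)) ?_
  intro U V hUV
  exact Subtype.ext (ext_h fun i => congrArg Subtype.val (congrFun hUV i))

/-! ### The subgroup `D_n` and other invariants -/

lemma refl_mem_weylD {i j : Fin n} (hij : i ≠ j) {s : ℝ} (hs : s = 1 ∨ s = -1) :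
    refl (h i + s • h j) ∈ weylD n :=
  Subgroup.subset_closure ⟨_, edge_mem_rootsD hij hs, rfl⟩

/-- Two coordinates are exchanged, and either both or neither change sign. This invariant separates
`weylD n` from `refl (h i)`, which negates the product. -/
lemma prod_refl_edge {i j : Fin n} (hij : i ≠ j) {s : ℝ} (hs : s = 1 ∨ s = -1) (x : E n) :
    ∏ k, refl (h i + s • h j) x k = ∏ k, x k := by
  have h1 : ∀ k, refl (h i + s • h j) x k =
      (if k = i ∨ k = j then -s else 1) * x (Equiv.swap i j k) := by
    intro k
    rw [refl_edge_apply hij hs]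
    by_cases hk : k = i
    · simp [hk]
    · by_cases hk' : k = j
      · simp [hk', hij.symm]
      · simp [hk, hk', Equiv.swap_apply_of_ne_of_ne hk hk']
  simp only [h1, Finset.prod_mul_distrib]
  rw [Equiv.prod_comp (Equiv.swap i j) fun k => x k,
    Finset.prod_eq_mul i j hij (fun k _ hk => by simp [hk.1, hk.2]) (by simp) (by simp)]
  rcases hs with rfl | rfl <;> simp

lemma prod_of_mem_weylD {U : Isom n} (hU : U ∈ weylD n) (x : E n) :
    ∏ k, U x k = ∏ k, x k := by
  induction hU using Subgroup.closure_induction generalizing x with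
  | mem g hg =>
    obtain ⟨v, hv, rfl⟩ := hg
    obtain ⟨i, j, s, a, hij, hs, ha, rfl⟩ := exists_edge_of_mem_rootsD hv
    rw [refl_smul ha, prod_refl_edge hij hs]
  | one => rfl
  | mul g k _ _ hg hk => exact (hg (k x)).trans (hk x)
  | inv g _ hg =>
    rw [← hg (g⁻¹ x)]
    exact congrArg (fun y : E n => ∏ k, y k) (g.apply_symm_apply x)

lemma refl_h_notMem_weylD (i : Fin n) : refl (h i) ∉ weylD n := by
  intro hmem
  have h1 := prod_of_mem_weylD hmem (WithLp.toLp 2 fun _ => (1 : ℝ))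
  simp only [refl_h_apply] at h1
  rw [Finset.prod_ite_eq_of_mem' _ _ _ (Finset.mem_univ i)] at h1
  norm_num at h1

lemma weylD_lt_weylB (hn : 2 ≤ n) : weylD n < weylB n := by
  refine lt_of_le_of_ne ?_ fun heq => ?_
  · exact Subgroup.closure_mono fun g ⟨v, hv, hg⟩ => ⟨v, Or.inr hv, hg⟩
  · refine refl_h_notMem_weylD (⟨0, by omega⟩ : Fin n) ?_
    rw [heq]
    exact (isRootLine_h _).refl_mem

lemma isReflectionGroup_weylD (n : ℕ) : IsReflectionGroup (weylD n) := by
  apply le_antisymm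
  · apply Subgroup.closure_mono
    rintro g ⟨v, hv, rfl⟩
    exact ⟨Subgroup.subset_closure ⟨v, hv, rfl⟩, v,
      (isRootLine_of_mem_rootsB (Or.inr hv)).ne_zero, rfl⟩
  · rw [Subgroup.closure_le]
    exact fun g hg => hg.1

lemma isMaximalRank_weylD (hn : 2 ≤ n) : IsMaximalRank (weylD n) := by
  intro x hx
  ext i
  have : Nontrivial (Fin n) := Fin.nontrivial_iff_two_le.2 hn
  obtain ⟨j, hj⟩ := exists_ne i
  have h1 := congrArg (fun y : E n => y i) (hx _ (refl_mem_weylD hj.symm (s := 1) (by simp)))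
  have h2 := congrArg (fun y : E n => y i) (hx _ (refl_mem_weylD hj.symm (s := -1) (by simp)))
  rw [refl_edge_apply hj.symm (by simp)] at h1 h2
  simp only [if_true] at h1 h2
  simp only [PiLp.zero_apply]
  linarith

/-- To be applied to a connected component `C`, which contains both ends of an edge or neither. -/
lemma sum_sq_refl_edge {C : Set (Fin n)} [DecidablePred (· ∈ C)] {i j : Fin n} (hij : i ≠ j)
    (hC : i ∈ C ↔ j ∈ C) {s : ℝ} (hs : s = 1 ∨ s = -1) (x : E n) :
    ∑ k, (if k ∈ C then refl (h i + s • h j) x k ^ 2 else 0) =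
      ∑ k, if k ∈ C then x k ^ 2 else 0 := by
  rw [← Equiv.sum_comp (Equiv.swap i j) fun k => if k ∈ C then x k ^ 2 else 0]
  refine Finset.sum_congr rfl fun k _ => ?_
  have hs2 : s ^ 2 = 1 := by rcases hs with rfl | rfl <;> norm_num
  rw [refl_edge_apply hij hs]
  by_cases hk : k = i
  · subst hk; simp [hC, mul_pow, hs2]
  · by_cases hk' : k = j
    · subst hk'; simp [hC, mul_pow, hs2, hij.symm]
    · simp [hk, hk', Equiv.swap_apply_of_ne_of_ne hk hk']

lemma sum_sq_refl_h {C : Set (Fin n)} [DecidablePred (· ∈ C)] (i : Fin n) (x : E n) :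
    ∑ k, (if k ∈ C then refl (h i) x k ^ 2 else 0) = ∑ k, if k ∈ C then x k ^ 2 else 0 := by
  refine Finset.sum_congr rfl fun k _ => ?_
  rw [refl_h_apply]
  by_cases hk : k = i <;> simp [hk]

/-! ### Graphs of embedded families -/

lemma refl_h_self (i : Fin n) : refl (h i) (h i) = -(h i : E n) := by
  ext k
  rw [refl_h_apply]
  by_cases hk : k = i <;> simp [h_apply, hk]

lemma refl_h_of_ne {i k : Fin n} (hk : k ≠ i) : refl (h i) (h k) = (h k : E n) :=
  refl_of_inner_eq_zero (by simp [h_apply, hk.symm])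

lemma refl_edge_left {i j : Fin n} (hij : i ≠ j) {s : ℝ} (hs : s = 1 ∨ s = -1) :
    refl (h i + s • h j) (h i) = -s • (h j : E n) := by
  ext k
  rw [refl_edge_apply hij hs]
  by_cases hk : k = i
  · subst hk; simp [h_apply, hij, hij.symm]
  · rcases eq_or_ne k j with rfl | hk' <;> simp [h_apply, *]

lemma refl_edge_of_ne {i j k : Fin n} (hi : k ≠ i) (hj : k ≠ j) (s : ℝ) :
    refl (h i + s • h j) (h k) = (h k : E n) :=
  refl_of_inner_eq_zero (by simp [inner_add_left, inner_smul_left, h_apply, hi.symm, hj.symm])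

lemma eq_of_smul_h_eq {i j : Fin n} {a b : ℝ} (ha : a ≠ 0) (hab : a • (h i : E n) = b • h j) :
    i = j := by
  by_contra hij
  have := congrArg (fun x : E n => x i) hab
  simp [h_apply, hij, ha] at this

lemma smul_h_ne_smul_edge {m i j : Fin n} (hij : i ≠ j) {s a b : ℝ} (hs : s = 1 ∨ s = -1)
    (ha : a ≠ 0) : a • (h m : E n) ≠ b • (h i + s • h j) := by
  intro hab
  have h1 := congrArg (fun x : E n => x i) hab
  have h2 := congrArg (fun x : E n => x j) hab
  have h3 := congrArg (fun x : E n => x m) hab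
  have hs0 : s ≠ 0 := by rcases hs with rfl | rfl <;> norm_num
  by_cases hi : m = i
  · subst hi
    simp [h_apply, hij, hij.symm, hs0] at h1 h2
    exact ha (h1.trans h2)
  · by_cases hj : m = j
    · subst hj
      simp [h_apply, hij, hij.symm] at h1 h2
      simp [← h1, ha] at h2
    · simp [h_apply, hi, hj, ha] at h3

lemma eq_of_smul_edge_eq {i j p q : Fin n} (hij : i ≠ j) (hpq : p ≠ q) {s t a b : ℝ}
    (hs : s = 1 ∨ s = -1) (ht : t = 1 ∨ t = -1) (ha : a ≠ 0)
    (hab : a • (h i + s • h j : E n) = b • (h p + t • h q)) :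
    s(i, j) = s(p, q) ∧ s = t := by
  have h1 := congrArg (fun x : E n => x i) hab
  have h2 := congrArg (fun x : E n => x j) hab
  have hs0 : s ≠ 0 := by rcases hs with rfl | rfl <;> norm_num
  have hi : i = p ∨ i = q := by
    by_contra! hcon
    simp [h_apply, hij, hcon.1, hcon.2, ha] at h1
  have hj : j = p ∨ j = q := by
    by_contra! hcon
    simp [h_apply, hij.symm, hcon.1, hcon.2, ha, hs0] at h2
  rcases hi with rfl | rfl
  · obtain rfl : j = q := hj.resolve_left hij.symm
    simp only [PiLp.smul_apply, PiLp.add_apply, h_apply, hij, hij.symm, if_true, if_false,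
      smul_eq_mul] at h1 h2
    refine ⟨rfl, mul_left_cancel₀ ha ?_⟩
    linear_combination h2 - t * h1
  · obtain rfl : j = p := hj.resolve_right hij.symm
    simp only [PiLp.smul_apply, PiLp.add_apply, h_apply, hij, hij.symm, if_true, if_false,
      smul_eq_mul] at h1 h2
    refine ⟨Sym2.eq_swap, mul_left_cancel₀ ha ?_⟩
    have htt : t * t = 1 := by rcases ht with rfl | rfl <;> norm_num
    linear_combination h2 - t * h1 - b * htt

lemma eq_sum_h (x : E n) : x = ∑ i, x i • h i := by
  ext k
  simp [h_apply]

lemma Family.hasNormal_smul_iff {Φ : Family n} {a : ℝ} (ha : a ≠ 0) {v : E n} :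
    Φ.HasNormal (a • v) ↔ Φ.HasNormal v := by
  constructor
  · rintro ⟨c, hc⟩
    exact ⟨c * a, by rwa [← smul_smul]⟩
  · rintro ⟨c, hc⟩
    exact ⟨c * a⁻¹, by rwa [smul_smul, mul_assoc, inv_mul_cancel₀ ha, mul_one]⟩

lemma Family.graph_adj_iff {Φ : Family n} {i j : Fin n} :
    Φ.graph.toSimpleGraph.Adj i j ↔
      i ≠ j ∧ ∃ s : ℝ, (s = 1 ∨ s = -1) ∧ Φ.HasNormal (h i + s • h j) := by
  classical
  have h0 : Φ.graph.toSimpleGraph.Adj i j ↔ Φ.graph.mult i j ≠ 0 := Iff.rfl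
  rw [h0]
  simp only [Family.graph]
  have h1 : (h i - h j : E n) = h i + (-1 : ℝ) • h j := by simp [sub_eq_add_neg]
  have h2 : (h i + h j : E n) = h i + (1 : ℝ) • h j := by simp
  rw [h1, h2]
  constructor
  · intro hne
    by_cases hij : i = j
    · simp [hij] at hne
    · refine ⟨hij, ?_⟩
      by_contra! hcon
      have ha := hcon 1 (by simp)
      have hb := hcon (-1) (by simp)
      simp only [hij, ha, hb, if_false] at hne
      exact hne rfl
  · rintro ⟨hij, s, rfl | rfl, hs⟩ <;> simp only [hij, hs, if_true, if_false] <;> omega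

lemma Family.graph_mult_le_one_iff {Φ : Family n} :
    (∀ i j, Φ.graph.mult i j ≤ 1) ↔
      ∀ i j, i ≠ j → Φ.HasNormal (h i + h j) → ¬ Φ.HasNormal (h i - h j) := by
  classical
  simp only [Family.graph]
  constructor
  · intro hle i j hij h1 h2
    have := hle i j
    simp [hij, h1, h2] at this
  · intro hne i j
    by_cases hij : i = j
    · simp [hij]
    · have := hne i j hij
      split_ifs <;> simp_all

lemma Family.mem_marked_iff {Φ : Family n} {i : Fin n} :
    i ∈ Φ.graph.marked ↔ Φ.HasNormal (h i) := Iff.rfl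

lemma _root_.SimpleGraph.Connected.induction {V : Type*} {G : SimpleGraph V} (hG : G.Connected)
    {p : V → Prop} (u : V) (hu : p u) (hstep : ∀ v w, G.Adj v w → p v → p w) (v : V) : p v := by
  have huv := hG.preconnected u v
  rw [SimpleGraph.reachable_iff_reflTransGen] at huv
  induction huv with
  | refl => exact hu
  | tail _ hadj ih => exact hstep _ _ hadj ih

/-! ### Families generating the whole Weyl group -/

lemma Family.HasSystem.refl_mem {Φ : Family n} {f : Fin n → E n} (hf : Φ.HasSystem f) {v : E n}
    (hv : Φ.HasNormal v) : refl v ∈ Subgroup.closure (Set.range fun i => refl (f i)) := by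
  obtain ⟨i, c, hc⟩ := hf.hasNormal_iff.1 hv
  have hc0 : c ≠ 0 := by
    rintro rfl
    have := hf.1.1 i
    simp [← hc] at this
  refine Subgroup.subset_closure ⟨i, ?_⟩
  simp only [← hc, refl_smul hc0]

lemma refl_apply_mem {G : Subgroup (Isom n)} {g : Isom n} (hg : g ∈ G) {v : E n}
    (hv : refl v ∈ G) : refl (g v) ∈ G := by
  rw [refl_map]
  exact G.mul_mem (G.mul_mem hg hv) (G.inv_mem hg)

lemma Family.HasSystem.closure_le {Φ : Family n} {f : Fin n → E n} (hf : Φ.HasSystem f)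
    (hΦ : Φ.IsEmbedded) : Subgroup.closure (Set.range fun i => refl (f i)) ≤ weylB n := by
  rw [Subgroup.closure_le]
  rintro _ ⟨i, rfl⟩
  exact (hf.isEmbedded_iff.1 hΦ i).refl_mem

/-- A group containing two reflections contains the reflection in the image of one root under the
other. This moves the marked `h m` along edges to every `h i`, and then the long roots starting at
`i` along walks from `i`. -/
lemma weylB_le_of_connected {Γ : SimpleGraph (Fin n)} (hΓ : Γ.Connected) {G : Subgroup (Isom n)}
    {m : Fin n} (hm : refl (h m) ∈ G)
    (hadj : ∀ i j, Γ.Adj i j → ∃ s : ℝ, (s = 1 ∨ s = -1) ∧ refl (h i + s • h j) ∈ G) :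
    weylB n ≤ G := by
  have h1 : ∀ i, refl (h i) ∈ G := by
    refine hΓ.induction m hm fun i j hij hi => ?_
    obtain ⟨s, hs, hr⟩ := hadj i j hij
    have := refl_apply_mem hr hi
    rw [refl_edge_left hij.ne hs] at this
    rcases hs with rfl | rfl
    · simpa [refl_neg] using this
    · simpa using this
  -- The alternative `i = j` starts the induction along walks, and covers walks that return to `i`.
  have h2 : ∀ i j, i = j ∨ ∀ s : ℝ, s = 1 ∨ s = -1 → refl (h i + s • h j) ∈ G := by
    intro i
    refine hΓ.induction i (Or.inl rfl) fun j k hjk hj => ?_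
    by_cases hik : i = k
    · exact Or.inl hik
    refine Or.inr fun s hs => ?_
    obtain ⟨t, ht, hr⟩ := hadj j k hjk
    rcases eq_or_ne i j with rfl | hij
    · have hst : s = t ∨ s = -t := by
        rcases hs with rfl | rfl <;> rcases ht with rfl | rfl <;> simp
      rcases hst with rfl | rfl
      · exact hr
      · have := refl_apply_mem (h1 k) hr
        rw [map_add, map_smul, refl_h_self, refl_h_of_ne hik] at this
        simpa using this
    -- The edge reflection sends `h j` to `-t • h k`, so `h i + (-t * s) • h j` is the root carried
    -- to `h i + s • h k`.
    · have hts : -t * s = 1 ∨ -t * s = -1 := by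
        rcases hs with rfl | rfl <;> rcases ht with rfl | rfl <;> simp
      have := refl_apply_mem hr (hj.resolve_left hij _ hts)
      rw [map_add, map_smul, refl_edge_left hjk.ne ht, refl_edge_of_ne hij hik, smul_smul] at this
      have htt : -t * s * -t = s := by rcases ht with rfl | rfl <;> ring
      rwa [htt] at this
  unfold weylB
  rw [Subgroup.closure_le]
  rintro _ ⟨v, hv, rfl⟩
  rcases isRootLine_of_mem_rootsB hv with ⟨i, a, ha, rfl⟩ | ⟨i, j, s, a, hij, hs, ha, rfl⟩
  · rw [refl_smul ha]
    exact h1 i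
  · rw [refl_smul ha]
    exact (h2 i j).resolve_left hij s hs

lemma Family.generates_of_isMarkedTree {Φ : Family n} (hΦ : Φ.IsEmbedded)
    (hT : Φ.graph.IsMarkedTree) : Φ.Generates (weylB n) := by
  obtain ⟨f, hf⟩ := Φ.exists_system
  obtain ⟨-, hT2, m, hm, -⟩ := hT
  rw [hf.generates_iff]
  refine le_antisymm (hf.closure_le hΦ) ?_
  refine weylB_le_of_connected hT2.connected (hf.refl_mem hm) fun i j hij => ?_
  obtain ⟨-, s, hs, hN⟩ := Family.graph_adj_iff.1 hij
  exact ⟨s, hs, hf.refl_mem hN⟩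

lemma card_map_conj (G : Subgroup (Isom n)) (U : Isom n) :
    Nat.card (G.map (MulAut.conj U).toMonoidHom) = Nat.card G :=
  (Nat.card_congr (G.equivMapOfInjective _ (MulAut.conj U).injective).toEquiv).symm

/-- A subgroup of a finite group with the same order is the whole group. -/
lemma Family.generates_of_generatesCopy {Φ : Family n} (hΦ : Φ.IsEmbedded)
    (hG : Φ.GeneratesCopy (weylB n)) : Φ.Generates (weylB n) := by
  obtain ⟨f, hf⟩ := Φ.exists_system
  obtain ⟨U, hU⟩ := hG
  rw [hf.generates_iff] at hU ⊢
  refine Subgroup.eq_of_le_of_card_ge (hf.closure_le hΦ) ?_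
  rw [hU, card_map_conj]

lemma Family.Generates.generatesCopy {Φ : Family n} {G : Subgroup (Isom n)}
    (hG : Φ.Generates G) : Φ.GeneratesCopy G := by
  refine ⟨1, ?_⟩
  have : (MulAut.conj (1 : Isom n)).toMonoidHom = MonoidHom.id _ := by
    ext1 g
    simp
  rwa [this, Subgroup.map_id]

lemma Family.connected_of_generates (hn : 2 ≤ n) {Φ : Family n} (hΦ : Φ.IsEmbedded)
    (hG : Φ.Generates (weylB n)) : Φ.graph.toSimpleGraph.Connected := by
  classical
  obtain ⟨f, hf⟩ := Φ.exists_system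
  rw [hf.generates_iff] at hG
  have : Nonempty (Fin n) := ⟨⟨0, by omega⟩⟩
  refine SimpleGraph.Connected.mk fun i j => ?_
  by_contra hij
  have hne : i ≠ j := by
    rintro rfl
    exact hij (SimpleGraph.Reachable.refl _)
  let C : Set (Fin n) := {k | Φ.graph.toSimpleGraph.Reachable i k}
  have hinv : ∀ g ∈ weylB n, ∀ x : E n,
      ∑ k, (if k ∈ C then g x k ^ 2 else 0) = ∑ k, if k ∈ C then x k ^ 2 else 0 := by
    intro g hg
    rw [← hG] at hg
    induction hg using Subgroup.closure_induction with
    | mem g hg =>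
      obtain ⟨l, rfl⟩ := hg
      intro x
      rcases hf.isEmbedded_iff.1 hΦ l with ⟨p, a, ha, hl⟩ | ⟨p, q, s, a, hpq, hs, ha, hl⟩
      · simp only [hl, refl_smul ha]
        exact sum_sq_refl_h p x
      · have hadj : Φ.graph.toSimpleGraph.Adj p q :=
          Family.graph_adj_iff.2 ⟨hpq, s, hs, hf.hasNormal_iff.2 ⟨l, a, hl.symm⟩⟩
        simp only [hl, refl_smul ha]
        exact sum_sq_refl_edge hpq ⟨fun hp => hp.trans hadj.reachable,
          fun hq => hq.trans hadj.symm.reachable⟩ hs x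
    | one => exact fun x => rfl
    | mul g k _ _ hg hk => exact fun x => (hg (k x)).trans (hk x)
    | inv g _ hg =>
      intro x
      rw [← hg (g⁻¹ x)]
      exact congrArg (fun y : E n => ∑ k, if k ∈ C then y k ^ 2 else 0) (g.apply_symm_apply x)
  -- This reflection takes `h i` to `h j`, which would change the sum over `C` from 1 to 0.
  have key := hinv _ (isRootLine_edge hne (s := -1) (by simp)).refl_mem (h i)
  rw [refl_edge_left hne (by simp)] at key
  have hiC : i ∈ C := SimpleGraph.Reachable.refl _
  have hjC : j ∉ C := hij
  have h1 : ∀ l : Fin n, (∑ k, if k ∈ C then (h l : E n) k ^ 2 else 0) = if l ∈ C then 1 else 0 := by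
    intro l
    rw [Finset.sum_eq_single l (fun k _ hk => by simp [h_apply, hk]) (by simp)]
    simp [h_apply]
  rw [neg_neg, one_smul, h1, h1] at key
  simp [hiC, hjC] at key

lemma Family.exists_marked_of_generates (hn : 2 ≤ n) {Φ : Family n} (hΦ : Φ.IsEmbedded)
    (hG : Φ.Generates (weylB n)) : ∃ m, m ∈ Φ.graph.marked := by
  obtain ⟨f, hf⟩ := Φ.exists_system
  rw [hf.generates_iff] at hG
  by_contra! hcon
  refine (weylD_lt_weylB hn).not_ge ?_
  rw [← hG, Subgroup.closure_le]
  rintro _ ⟨l, rfl⟩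
  rcases hf.isEmbedded_iff.1 hΦ l with ⟨p, a, ha, hl⟩ | ⟨p, q, s, a, hpq, hs, ha, hl⟩
  · exact absurd (hf.hasNormal_iff.2 ⟨l, a, hl.symm⟩) (hcon p)
  · simp only [hl, refl_smul ha]
    exact refl_mem_weylD hpq hs

/-- Linear counterpart of the propagation of reflections: from `h i` and an edge vector one recovers
`h j`. It yields both the redundancy of superfluous normals and the independence of the system built
from a tree. -/
lemma eq_top_of_connected {Γ : SimpleGraph (Fin n)} (hΓ : Γ.Connected)
    {W : Submodule ℝ (E n)} {m : Fin n} (hm : h m ∈ W)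
    (hadj : ∀ i j, Γ.Adj i j → ∃ s : ℝ, (s = 1 ∨ s = -1) ∧ h i + s • h j ∈ W) : W = ⊤ := by
  have h1 : ∀ i, h i ∈ W := by
    refine hΓ.induction m hm fun i j hij hi => ?_
    obtain ⟨s, hs, hr⟩ := hadj i j hij
    have h2 := W.smul_mem s (W.sub_mem hr hi)
    rw [add_sub_cancel_left, smul_smul] at h2
    have hss : s * s = 1 := by rcases hs with rfl | rfl <;> norm_num
    rwa [hss, one_smul] at h2
  rw [eq_top_iff]
  intro x _
  rw [eq_sum_h x]
  exact W.sum_mem fun i _ => W.smul_mem _ (h1 i)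

/-- A normal of an independent system cannot be dispensed with: the remaining ones do not contain
a marked vertex together with the edges of a connected graph. -/
lemma Family.HasSystem.false_of_connected {Φ : Family n} {f : Fin n → E n} (hf : Φ.HasSystem f)
    (k : Fin n) {Γ : SimpleGraph (Fin n)} (hΓ : Γ.Connected) {m : Fin n}
    (hm : ∃ l, ∃ c : ℝ, l ≠ k ∧ c • h m = f l)
    (hadj : ∀ i j, Γ.Adj i j → ∃ s : ℝ, (s = 1 ∨ s = -1) ∧
      ∃ l, ∃ c : ℝ, l ≠ k ∧ c • (h i + s • h j) = f l) : False := by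
  have hmem : ∀ v l (c : ℝ), l ≠ k → c • v = f l → v ∈ Submodule.span ℝ (f '' {l | l ≠ k}) := by
    intro v l c hl hc
    have hc0 : c ≠ 0 := by
      rintro rfl
      have := hf.1.1 l
      simp [← hc] at this
    have h1 : f l ∈ Submodule.span ℝ (f '' {l | l ≠ k}) := Submodule.subset_span ⟨l, hl, rfl⟩
    have h2 := Submodule.smul_mem _ c⁻¹ h1
    rwa [← hc, smul_smul, inv_mul_cancel₀ hc0, one_smul] at h2
  have htop : Submodule.span ℝ (f '' {l | l ≠ k}) = ⊤ := by
    obtain ⟨l, c, hl, hc⟩ := hm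
    refine eq_top_of_connected hΓ (hmem _ l c hl hc) fun i j hij => ?_
    obtain ⟨s, hs, l, c, hl, hc⟩ := hadj i j hij
    exact ⟨s, hs, hmem _ l c hl hc⟩
  exact hf.1.2.notMem_span_image (s := {l | l ≠ k}) (x := k) (by simp) (by simp [htop])

lemma Family.isMarkedTree_of_generates (hn : 2 ≤ n) {Φ : Family n} (hΦ : Φ.IsEmbedded)
    (hG : Φ.Generates (weylB n)) : Φ.graph.IsMarkedTree := by
  have hconn := Family.connected_of_generates hn hΦ hG
  obtain ⟨m, hm⟩ := Family.exists_marked_of_generates hn hΦ hG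
  obtain ⟨f, hf⟩ := Φ.exists_system
  have hne : ∀ (l : Fin n) (c : ℝ) (v : E n), c • v = f l → c ≠ 0 := by
    rintro l c v hc rfl
    have := hf.1.1 l
    simp [← hc] at this
  obtain ⟨lm, cm, hcm⟩ := hf.hasNormal_iff.1 hm
  refine ⟨?_, ⟨hconn, ?_⟩, m, hm, fun m' hm' => ?_⟩
  · rw [Family.graph_mult_le_one_iff]
    intro i j hij h1 h2
    obtain ⟨l, c, hc⟩ := hf.hasNormal_iff.1 h1
    obtain ⟨k, d, hd⟩ := hf.hasNormal_iff.1 h2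
    have hd0 := hne _ _ _ hd
    have hc0 := hne _ _ _ hc
    have hd' : d • (h i + (-1 : ℝ) • h j) = f k := by simpa [sub_eq_add_neg] using hd
    have hc' : c • (h i + (1 : ℝ) • h j) = f l := by simpa using hc
    have hlk : l ≠ k := by
      rintro rfl
      have := (eq_of_smul_edge_eq hij hij (by simp) (by simp) hc0 (hc'.trans hd'.symm)).2
      norm_num at this
    -- Of two parallel edges, `f k` is dropped and `f l` keeps the graph connected.
    refine hf.false_of_connected k hconn ⟨lm, cm, ?_, hcm⟩ fun p q hpq => ?_
    · rintro rfl
      exact smul_h_ne_smul_edge hij (by simp) (hne _ _ _ hcm) (hcm.trans hd'.symm)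
    · obtain ⟨hpq, s, hs, hN⟩ := Family.graph_adj_iff.1 hpq
      obtain ⟨l', c', hc''⟩ := hf.hasNormal_iff.1 hN
      by_cases hl' : l' = k
      · subst hl'
        have := (eq_of_smul_edge_eq hij hpq (by simp) hs hd0 (hd'.trans hc''.symm)).1
        refine ⟨1, by simp, l, c, hlk, ?_⟩
        rw [← hc, one_smul]
        rcases Sym2.eq_iff.1 this with ⟨rfl, rfl⟩ | ⟨rfl, rfl⟩
        · rfl
        · rw [add_comm]
      · exact ⟨s, hs, l', c', hl', hc''⟩
  -- An edge that is not a bridge can be deleted without disconnecting the graph, so its normal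
  -- would be redundant.
  · rw [SimpleGraph.isAcyclic_iff_forall_adj_isBridge]
    intro i j hadj
    by_contra hbr
    have hdel := hconn.connected_delete_edge_of_not_isBridge hbr
    obtain ⟨hij, s, hs, hN⟩ := Family.graph_adj_iff.1 hadj
    obtain ⟨k, d, hd⟩ := hf.hasNormal_iff.1 hN
    have hd0 := hne _ _ _ hd
    refine hf.false_of_connected k hdel ⟨lm, cm, ?_, hcm⟩ fun p q hpq => ?_
    · rintro rfl
      exact smul_h_ne_smul_edge hij hs (hne _ _ _ hcm) (hcm.trans hd.symm)
    · rw [SimpleGraph.deleteEdges_adj] at hpq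
      obtain ⟨hpq1, hpq2⟩ := hpq
      obtain ⟨hpq, t, ht, hN⟩ := Family.graph_adj_iff.1 hpq1
      obtain ⟨l, c, hc⟩ := hf.hasNormal_iff.1 hN
      refine ⟨t, ht, l, c, ?_, hc⟩
      rintro rfl
      exact hpq2 (eq_of_smul_edge_eq hpq hij ht hs (hne _ _ _ hc) (hc.trans hd.symm)).1
  · by_contra hmm
    obtain ⟨k, d, hd⟩ := hf.hasNormal_iff.1 (Family.mem_marked_iff.1 hm')
    refine hf.false_of_connected k hconn ⟨lm, cm, ?_, hcm⟩ fun p q hpq => ?_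
    · rintro rfl
      exact hmm (eq_of_smul_h_eq (hne _ _ _ hd) (hd.trans hcm.symm))
    · obtain ⟨hpq, s, hs, hN⟩ := Family.graph_adj_iff.1 hpq
      obtain ⟨l, c, hc⟩ := hf.hasNormal_iff.1 hN
      refine ⟨s, hs, l, c, ?_, hc⟩
      rintro rfl
      exact smul_h_ne_smul_edge hpq hs (hne _ _ _ hd) (hd.trans hc.symm)

/-! ### Isometries of families -/

lemma Family.HasSystem.map {Φ Ψ : Family n} {f : Fin n → E n} (hf : Φ.HasSystem f) {U : Isom n}
    (hU : Family.MapsTo U Φ Ψ) : Ψ.HasSystem fun i => U (f i) := by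
  refine ⟨hf.1.map U, ?_⟩
  rw [← hU, hf.2, image_simplicesOf]

lemma Family.Generates.map {Φ Ψ : Family n} {G : Subgroup (Isom n)} (hG : Φ.Generates G)
    {U : Isom n} (hU : Family.MapsTo U Φ Ψ) :
    Ψ.Generates (G.map (MulAut.conj U).toMonoidHom) := by
  obtain ⟨f, hf⟩ := Φ.exists_system
  rw [(hf.map hU).generates_iff, ← hf.generates_iff.1 hG, MonoidHom.map_closure, ← Set.range_comp]
  congr 2
  funext i
  simp [refl_map]

lemma Family.GeneratesCopy.of_isometric {Φ Ψ : Family n} {G : Subgroup (Isom n)}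
    (hG : Φ.GeneratesCopy G) (hΦΨ : Family.Isometric Φ Ψ) : Ψ.GeneratesCopy G := by
  obtain ⟨V, hV⟩ := hG
  obtain ⟨U, hU⟩ := hΦΨ
  refine ⟨U * V, ?_⟩
  have := hV.map hU
  rw [Subgroup.map_map] at this
  convert this using 2
  ext1 g
  simp

lemma Family.Generates.unique {Φ : Family n} {G H : Subgroup (Isom n)} (hG : Φ.Generates G)
    (hH : Φ.Generates H) : G = H := by
  obtain ⟨f, hf⟩ := Φ.exists_system
  rw [← hf.generates_iff.1 hG, hf.generates_iff.1 hH]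

lemma Family.hasNormal_map_iff {Φ Ψ : Family n} {U : Isom n} (hU : Family.MapsTo U Φ Ψ)
    {v : E n} : Ψ.HasNormal (U v) ↔ Φ.HasNormal v := by
  obtain ⟨f, hf⟩ := Φ.exists_system
  rw [(hf.map hU).hasNormal_iff, hf.hasNormal_iff]
  simp only [← map_smul, U.injective.eq_iff]

lemma Family.exists_isEmbedded {Φ : Family n} (hG : Φ.GeneratesCopy (weylB n)) :
    ∃ Ψ : Family n, Ψ.IsEmbedded ∧ Family.Isometric Φ Ψ := by
  obtain ⟨f, hf⟩ := Φ.exists_system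
  obtain ⟨U, hU⟩ := hG
  have hΨ : Family.MapsTo U⁻¹ Φ (hf.1.map U⁻¹).family :=
    (congrArg (fun S => (fun P : Set (E n) => (U⁻¹ : Isom n) '' P) '' S) hf.2).trans
      (image_simplicesOf _ _)
  refine ⟨_, (hf.map hΨ).isEmbedded_iff.2 fun i => ?_, U⁻¹, hΨ⟩
  have hne : U⁻¹ (f i) ≠ 0 := by
    intro h0
    have := (hf.1.map U⁻¹).1 i
    simp only [h0, norm_zero] at this
    norm_num at this
  refine isRootLine_of_refl_mem hne ?_
  have hmem : refl (f i) ∈ (weylB n).map (MulAut.conj U).toMonoidHom := by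
    rw [← hf.generates_iff.1 hU]
    exact Subgroup.subset_closure ⟨i, rfl⟩
  obtain ⟨g, hg, hgf⟩ := hmem
  have hgf' : U * g * U⁻¹ = refl (f i) := hgf
  rw [refl_map, ← hgf']
  simpa [mul_assoc] using hg

/-- Suppose `h i` goes to a long root line. The angle π/4 between `h i` and `h i + h j` does not
occur between long root lines, so each `h i + h j` goes to a short one. For two different `j` these
vectors enclose the angle π/3, while short lines are equal or orthogonal. Three indices are needed.
-/
lemma isSignedPerm_of_preserves (hn : 3 ≤ n) {U : Isom n}
    (hU : ∀ v, IsRootLine v → IsRootLine (U v)) : IsSignedPerm U := by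
  intro i
  rcases hU _ (isRootLine_h i) with ⟨j, a, ha, hj⟩ | ⟨p, q, s, a, hpq, hs, ha, hi⟩
  · have h1 : |a| = 1 := by
      have := congrArg norm hj
      simpa [norm_smul] using this.symm
    refine ⟨j, ?_⟩
    rcases eq_or_eq_neg_of_abs_eq h1 with rfl | rfl
    · left; simpa using hj
    · right; simpa using hj
  exfalso
  have ha2 : a ^ 2 * 2 = 1 := by
    have := congrArg (fun x => ‖x‖ ^ 2) hi
    simp only [U.norm_map, norm_h, norm_smul, mul_pow, norm_edge_sq hpq hs] at this
    simpa using this.symm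
  have key : ∀ j, j ≠ i → ∃ c, ∃ b : ℝ, b ^ 2 = 2 ∧ U (h i + (1 : ℝ) • h j) = b • h c := by
    intro j hj
    have hnorm := norm_edge_sq hj.symm (s := 1) (by simp)
    have hinner : inner ℝ (U (h i)) (U (h i + (1 : ℝ) • h j)) = (1 : ℝ) := by
      rw [U.inner_map_map]
      simp [h_apply, hj.symm]
    rcases hU _ (isRootLine_edge hj.symm (s := 1) (by simp)) with
      ⟨c, b, hb, hc⟩ | ⟨c, d, t, b, hcd, ht, hb, hc⟩
    · refine ⟨c, b, ?_, hc⟩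
      rw [← U.norm_map, hc, norm_smul, mul_pow] at hnorm
      simpa using hnorm
    · exfalso
      have hb2 : b ^ 2 = 1 := by
        rw [← U.norm_map, hc, norm_smul, mul_pow, norm_edge_sq hcd ht] at hnorm
        simpa using hnorm
      rw [hi, hc, inner_smul_left, inner_smul_right, inner_add_left, inner_smul_left, inner_h,
        inner_h] at hinner
      simp only [RCLike.conj_to_real, PiLp.add_apply, PiLp.smul_apply, h_apply,
        smul_eq_mul] at hinner
      -- `N` is the inner product of two long roots, hence an integer, and the norms force `N ^ 2 =
      -- 2`.
      set N : ℝ := ((if p = c then 1 else 0) + t * (if p = d then 1 else 0) +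
        s * ((if q = c then 1 else 0) + t * (if q = d then 1 else 0))) with hN
      have hN2 : N ^ 2 = 2 := by
        have h1 : (a * (b * N)) ^ 2 = 1 := by rw [hinner, one_pow]
        have h2 : a ^ 2 * b ^ 2 * N ^ 2 = 1 := by rw [← h1]; ring
        rw [hb2] at h2
        linear_combination 2 * h2 - N ^ 2 * ha2
      rw [hN] at hN2
      rcases hs with rfl | rfl <;> rcases ht with rfl | rfl <;> split_ifs at hN2 <;>
        norm_num at hN2
  obtain ⟨j, hj⟩ : ∃ j, j ∉ ({i} : Finset (Fin n)) := by
    by_contra! hcon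
    have := Finset.card_le_card (s := Finset.univ) fun x _ => hcon x
    simp at this
    omega
  obtain ⟨k, hk⟩ : ∃ k, k ∉ ({i, j} : Finset (Fin n)) := by
    by_contra! hcon
    have := (Finset.card_le_card (s := Finset.univ) fun x _ => hcon x).trans Finset.card_le_two
    simp at this
    omega
  simp only [Finset.mem_singleton, Finset.mem_insert, not_or] at hj hk
  obtain ⟨c, b, hb, hc⟩ := key j hj
  obtain ⟨c', b', hb', hc'⟩ := key k hk.1
  have hinner : inner ℝ (U (h i + (1 : ℝ) • h j)) (U (h i + (1 : ℝ) • h k)) = (1 : ℝ) := by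
    rw [U.inner_map_map]
    simp [inner_add_left, h_apply, hj, Ne.symm hk.1, Ne.symm hk.2]
  rw [hc, hc', inner_smul_left, inner_smul_right, inner_h, h_apply] at hinner
  simp only [RCLike.conj_to_real] at hinner
  split_ifs at hinner
  · have h1 : (b * (b' * 1)) ^ 2 = 1 := by rw [hinner, one_pow]
    have h2 : b ^ 2 * b' ^ 2 = 1 := by rw [← h1]; ring
    rw [hb, hb'] at h2
    norm_num at h2
  · norm_num at hinner

/-- Both families generate `weylB n`, so `U` normalizes it and permutes its reflections. -/
lemma mem_weylB_of_mapsTo (hn : 3 ≤ n) {Φ Ψ : Family n} (hΦ : Φ.Generates (weylB n))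
    (hΨ : Ψ.Generates (weylB n)) {U : Isom n} (hU : Family.MapsTo U Φ Ψ) : U ∈ weylB n := by
  refine (isSignedPerm_of_preserves hn fun v hv => ?_).mem_weylB
  refine isRootLine_of_refl_mem (by simpa using hv.ne_zero) ?_
  rw [hΨ.unique (hΦ.map hU), refl_map]
  exact ⟨refl v, hv.refl_mem, rfl⟩

/-! ### Isometric families have isomorphic graphs -/

lemma MarkedGraph.iso_of_adj_iff {S T : MarkedGraph n} (hS : ∀ i j, S.mult i j ≤ 1)
    (hT : ∀ i j, T.mult i j ≤ 1) (σ : Equiv.Perm (Fin n))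
    (hσ : ∀ i j, T.toSimpleGraph.Adj (σ i) (σ j) ↔ S.toSimpleGraph.Adj i j)
    (hm : ∀ i, σ i ∈ T.marked ↔ i ∈ S.marked) : MarkedGraph.Iso S T := by
  refine ⟨σ, fun i j => ?_, hm⟩
  have h1 : T.mult (σ i) (σ j) ≠ 0 ↔ S.mult i j ≠ 0 := hσ i j
  have h2 := hS i j
  have h3 := hT (σ i) (σ j)
  omega

/-- A signed permutation alters edges only by its underlying permutation and by signs, and the graph
forgets the signs. -/
lemma Family.graph_iso_of_mapsTo {Φ Ψ : Family n} (hΦ : Φ.graph.IsMarkedTree)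
    (hΨ : Ψ.graph.IsMarkedTree) {w : Isom n} (hw : w ∈ weylB n) (hΦΨ : Family.MapsTo w Φ Ψ) :
    MarkedGraph.Iso Φ.graph Ψ.graph := by
  obtain ⟨σ, s, hs, hσ⟩ := (mem_weylB_iff.1 hw).exists_perm
  have hs0 : ∀ i, s i ≠ 0 := fun i => by rcases hs i with h | h <;> simp [h]
  have hss : ∀ i, s i * s i = 1 := fun i => by rcases hs i with h | h <;> simp [h]
  have key : ∀ i j (t : ℝ), Φ.HasNormal (h i + (s i * t * s j) • h j) ↔
      Ψ.HasNormal (h (σ i) + t • h (σ j)) := by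
    intro i j t
    have h1 : w (h i + (s i * t * s j) • h j) = s i • (h (σ i) + t • h (σ j)) := by
      rw [map_add, map_smul, hσ, hσ, smul_add, smul_smul, smul_smul, mul_assoc _ (s j), hss,
        mul_one]
    rw [← Family.hasNormal_map_iff hΦΨ, h1, Family.hasNormal_smul_iff (hs0 i)]
  have hpm : ∀ i j (t : ℝ), t = 1 ∨ t = -1 → s i * t * s j = 1 ∨ s i * t * s j = -1 := by
    rintro i j t (rfl | rfl) <;> rcases hs i with h | h <;> rcases hs j with h' | h' <;>
      simp [h, h']
  refine MarkedGraph.iso_of_adj_iff hΦ.1 hΨ.1 σ (fun i j => ?_) fun i => ?_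
  · rw [Family.graph_adj_iff, Family.graph_adj_iff, σ.injective.ne_iff]
    refine and_congr_right fun _ => ⟨?_, ?_⟩
    · rintro ⟨t, ht, hN⟩
      exact ⟨_, hpm i j t ht, (key i j t).2 hN⟩
    · rintro ⟨t, ht, hN⟩
      refine ⟨_, hpm i j t ht, (key i j _).1 ?_⟩
      have : s i * (s i * t * s j) * s j = t := by
        linear_combination (t * s j * s j) * hss i + t * hss j
      rwa [this]
  · rw [Family.mem_marked_iff, Family.mem_marked_iff, ← Family.hasNormal_map_iff hΦΨ, hσ,
      Family.hasNormal_smul_iff (hs0 i)]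

/-- On two vertices the tree is a single edge, and a transposition matches the marks. This replaces
the rigidity of isometries, which fails in the plane. -/
lemma MarkedGraph.iso_of_two {S T : MarkedGraph 2} (hS : S.IsMarkedTree) (hT : T.IsMarkedTree) :
    MarkedGraph.Iso S T := by
  have hadj : ∀ R : MarkedGraph 2, R.IsMarkedTree → ∀ i j, R.toSimpleGraph.Adj i j ↔ i ≠ j := by
    intro R hR i j
    refine ⟨fun hij => hij.ne, fun hij => ?_⟩
    have := hR.2.1.connected.induction (p := fun v => v = i ∨ R.toSimpleGraph.Adj i v) i
      (Or.inl rfl) (fun v w hvw hv => ?_) j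
    · exact this.resolve_left hij.symm
    · rcases hv with rfl | hv
      · exact Or.inr hvw
      · have h1 := hv.ne
        have h2 := hvw.ne
        left
        omega
  obtain ⟨m, hm, hm'⟩ := hS.2.2
  obtain ⟨k, hk, hk'⟩ := hT.2.2
  refine MarkedGraph.iso_of_adj_iff hS.1 hT.1 (Equiv.swap m k) (fun i j => ?_) fun i => ?_
  · rw [hadj T hT, hadj S hS, (Equiv.swap m k).injective.ne_iff]
  · have h1 : i ∈ S.marked ↔ i = m := ⟨hm' i, fun h => h ▸ hm⟩
    have h2 : Equiv.swap m k i ∈ T.marked ↔ Equiv.swap m k i = k := ⟨hk' _, fun h => by rwa [h]⟩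
    rw [h1, h2, Equiv.swap_apply_eq_iff, Equiv.swap_apply_right]

/-! ### Families with isomorphic graphs are equivalent under the Weyl group -/

/-- `s v` is the product of `t` along the unique path from a fixed root to `v`. For adjacent
vertices one of the two paths extends the other by the edge, and since `t` is a sign and symmetric,
the direction does not matter. -/
lemma _root_.SimpleGraph.IsTree.exists_potential {V : Type*} {G : SimpleGraph V} (hG : G.IsTree)
    (t : V → V → ℝ) (ht : ∀ i j, t i j = 1 ∨ t i j = -1) (hsymm : ∀ i j, t i j = t j i) :
    ∃ s : V → ℝ, (∀ i, s i = 1 ∨ s i = -1) ∧ ∀ i j, G.Adj i j → s j = s i * t i j := by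
  obtain ⟨u⟩ := hG.connected.nonempty
  choose p hp _ using fun v => hG.existsUnique_path u v
  have hconcat : ∀ v w (hadj : G.Adj v w), p w = (p v).concat hadj →
      ((p w).darts.map fun d => t d.fst d.snd).prod =
        ((p v).darts.map fun d => t d.fst d.snd).prod * t v w := by
    intro v w hadj hpw
    rw [hpw, SimpleGraph.Walk.darts_concat]
    simp
  refine ⟨fun v => ((p v).darts.map fun d => t d.fst d.snd).prod, fun v => ?_,
    fun v w hadj => ?_⟩
  · show ((p v).darts.map fun d => t d.fst d.snd).prod = 1 ∨
      ((p v).darts.map fun d => t d.fst d.snd).prod = -1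
    induction (p v).darts with
    | nil => simp
    | cons d l ih =>
      simp only [List.map_cons, List.prod_cons]
      rcases ht d.fst d.snd with h1 | h1 <;> rcases ih with h2 | h2 <;> simp [h1, h2]
  · by_cases hv : v ∈ (p w).support
    · exact hconcat v w hadj (hG.isAcyclic.path_concat (hp v) (hp w) hadj hv)
    · have hw := hG.isAcyclic.mem_support_of_ne_mem_support_of_adj_of_isPath (hp v) (hp w) hadj hv
      have h1 := hconcat w v hadj.symm (hG.isAcyclic.path_concat (hp w) (hp v) hadj.symm hw)
      simp only [h1, hsymm w v, mul_assoc]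
      rcases ht v w with h2 | h2 <;> simp [h2]

lemma exists_signedPerm (σ : Equiv.Perm (Fin n)) (s : Fin n → ℝ) (hs : ∀ i, s i = 1 ∨ s i = -1) :
    ∃ w ∈ weylB n, ∀ i, w (h i) = s i • h (σ i) := by
  classical
  let d : Isom n := LinearIsometryEquiv.piLpCongrRight 2 fun i =>
    if s i = 1 then LinearIsometryEquiv.refl ℝ ℝ else LinearIsometryEquiv.neg ℝ
  let p : Isom n := LinearIsometryEquiv.piLpCongrLeft 2 ℝ ℝ σ
  have hd : ∀ i, d (h i) = s i • h i := by
    intro i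
    ext k
    change (if s k = 1 then LinearIsometryEquiv.refl ℝ ℝ else LinearIsometryEquiv.neg ℝ)
      ((h i : E n) k) = _
    by_cases hk : k = i
    · subst hk
      rcases hs k with h1 | h1
      · simp [h1]
      · rw [if_neg (by rw [h1]; norm_num)]
        simp [h1]
    · simp [h_apply, hk]
  have hp : ∀ i, p (h i) = h (σ i) := fun i => LinearIsometryEquiv.piLpCongrLeft_single σ i 1
  have hw : ∀ i, (p * d) (h i) = s i • h (σ i) := by
    intro i
    change p (d (h i)) = _
    rw [hd, map_smul, hp]
  refine ⟨p * d, IsSignedPerm.mem_weylB fun i => ⟨σ i, ?_⟩, hw⟩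
  rw [hw]
  rcases hs i with h1 | h1 <;> simp [h1]

open Classical in
/-- The sign of an edge of the graph of a family. -/
noncomputable def Family.edgeSign (Φ : Family n) (i j : Fin n) : ℝ :=
  if Φ.HasNormal (h i + h j) then 1 else -1

lemma Family.edgeSign_eq (Φ : Family n) (i j : Fin n) :
    Φ.edgeSign i j = 1 ∨ Φ.edgeSign i j = -1 := by
  unfold Family.edgeSign
  split_ifs <;> simp

lemma Family.edgeSign_comm (Φ : Family n) (i j : Fin n) : Φ.edgeSign i j = Φ.edgeSign j i := by
  unfold Family.edgeSign
  rw [add_comm]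

lemma Family.eq_edgeSign {Φ : Family n} (hΦ : Φ.graph.IsMarkedTree) {i j : Fin n} (hij : i ≠ j)
    {s : ℝ} (hs : s = 1 ∨ s = -1) (hN : Φ.HasNormal (h i + s • h j)) : s = Φ.edgeSign i j := by
  unfold Family.edgeSign
  rcases hs with rfl | rfl
  · rw [if_pos (by simpa using hN)]
  · rw [if_neg]
    intro h1
    exact Family.graph_mult_le_one_iff.1 hΦ.1 i j hij h1 (by simpa [sub_eq_add_neg] using hN)

/-- If an edge has sign `c` in `Φ` and its image has sign `d` in `Ψ`, a signed permutation over `σ`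
matches them exactly when `s j = s i * (c * d)`; a tree admits such a choice of `s`. -/
lemma Family.exists_mapsTo_of_graph_iso {Φ Ψ : Family n} (hΦ : Φ.IsEmbedded)
    (hΦT : Φ.graph.IsMarkedTree) (hΨT : Ψ.graph.IsMarkedTree)
    (hiso : MarkedGraph.Iso Φ.graph Ψ.graph) : ∃ w ∈ weylB n, Family.MapsTo w Φ Ψ := by
  obtain ⟨σ, hσ, hσm⟩ := hiso
  -- For non-adjacent pairs `edgeSign` has a default value, of which only its being `±1` is used.
  obtain ⟨s, hs, hpot⟩ := hΦT.2.1.exists_potential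
    (fun i j => Φ.edgeSign i j * Ψ.edgeSign (σ i) (σ j))
    (fun i j => by
      rcases Φ.edgeSign_eq i j with h1 | h1 <;>
        rcases Ψ.edgeSign_eq (σ i) (σ j) with h2 | h2 <;> simp [h1, h2])
    (fun i j => by simp only [Family.edgeSign_comm _ i j, Family.edgeSign_comm _ (σ i)])
  obtain ⟨w, hwB, hw⟩ := exists_signedPerm σ s hs
  refine ⟨w, hwB, ?_⟩
  have hs0 : ∀ i, s i ≠ 0 := fun i => by rcases hs i with h | h <;> simp [h]
  have key : ∀ v, IsRootLine v → Φ.HasNormal v → Ψ.HasNormal (w v) := by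
    rintro v (⟨i, a, ha, rfl⟩ | ⟨i, j, c, a, hij, hc, ha, rfl⟩) hN
    · rw [Family.hasNormal_smul_iff ha] at hN
      rw [map_smul, hw, Family.hasNormal_smul_iff ha, Family.hasNormal_smul_iff (hs0 i)]
      exact (hσm i).2 hN
    · rw [Family.hasNormal_smul_iff ha] at hN
      have hadj : Φ.graph.toSimpleGraph.Adj i j := Family.graph_adj_iff.2 ⟨hij, c, hc, hN⟩
      have hadj' : Ψ.graph.toSimpleGraph.Adj (σ i) (σ j) := by
        change Ψ.graph.mult (σ i) (σ j) ≠ 0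
        rw [hσ]
        exact hadj
      obtain ⟨hij', d, hd, hN'⟩ := Family.graph_adj_iff.1 hadj'
      have hcc : c * c = 1 := by rcases hc with rfl | rfl <;> norm_num
      have h1 : w (h i + c • h j) = s i • (h (σ i) + d • h (σ j)) := by
        rw [map_add, map_smul, hw, hw, hpot i j hadj, ← Family.eq_edgeSign hΦT hij hc hN,
          ← Family.eq_edgeSign hΨT hij' hd hN', smul_add, smul_smul, smul_smul]
        congr 2
        linear_combination (s i * d) * hcc
      rwa [map_smul, Family.hasNormal_smul_iff ha, h1, Family.hasNormal_smul_iff (hs0 i)]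
  obtain ⟨f, hf⟩ := Φ.exists_system
  obtain ⟨f', hf'⟩ := Ψ.exists_system
  rw [Family.mapsTo_iff hf hf']
  intro i
  obtain ⟨j, c, hc⟩ := hf'.hasNormal_iff.1
    (key (f i) (hf.isEmbedded_iff.1 hΦ i) (hf.hasNormal_iff.2 ⟨i, 1, one_smul _ _⟩))
  have hcabs : |c| = 1 := by
    have := congrArg norm hc
    simpa [norm_smul, hf.1.1, hf'.1.1] using this
  refine ⟨j, ?_⟩
  rcases eq_or_eq_neg_of_abs_eq hcabs with rfl | rfl
  · left; simpa using hc
  · right; rw [← hc]; simp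

/-! ### Families with prescribed graph -/

/-- A tree has `n - 1` edges, so with the mark there are `n` vectors; they span, hence are
independent. All edges get the sign `-1`, which is harmless since signs can be changed by the Weyl
group. -/
lemma exists_system_of_isMarkedTree {Γ : SimpleGraph (Fin n)} (hΓ : Γ.IsTree) (m : Fin n) :
    ∃ f : Fin n → E n, IsNormalSystem f ∧
      (∀ l, f l = h m ∨ ∃ i j, Γ.Adj i j ∧ ∃ a : ℝ, a ≠ 0 ∧ f l = a • (h i + (-1 : ℝ) • h j)) ∧
      (∃ l, f l = h m) ∧
      ∀ i j, Γ.Adj i j → ∃ l, ∃ a : ℝ, a ≠ 0 ∧ f l = a • (h i + (-1 : ℝ) • h j) := by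
  classical
  have hex : ∀ e : Γ.edgeSet, ∃ p : Fin n × Fin n, e.1 = s(p.1, p.2) ∧ Γ.Adj p.1 p.2 := by
    rintro ⟨e, he⟩
    induction e using Sym2.ind with
    | _ i j => exact ⟨(i, j), rfl, he⟩
  choose p hp hpadj using hex
  have hcard : Fintype.card (Option Γ.edgeSet) = Fintype.card (Fin n) := by
    rw [Fintype.card_option, ← hΓ.card_edgeFinset, SimpleGraph.edgeFinset, Set.toFinset_card]
  -- `none` stands for the marked vertex.
  let ι : Fin n ≃ Option Γ.edgeSet := (Fintype.equivOfCardEq hcard).symm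
  let g : Option Γ.edgeSet → E n := fun o =>
    o.elim (h m) fun e => (√2)⁻¹ • (h (p e).1 + (-1 : ℝ) • h (p e).2)
  have h2 : (√2)⁻¹ ≠ 0 := by positivity
  have hedge : ∀ i j, Γ.Adj i j → ∃ l, ∃ a : ℝ, a ≠ 0 ∧ g (ι l) = a • (h i + (-1 : ℝ) • h j) := by
    intro i j hij
    refine ⟨ι.symm (some ⟨s(i, j), hij⟩), ?_⟩
    rw [ι.apply_symm_apply]
    rcases Sym2.eq_iff.1 (hp ⟨s(i, j), hij⟩) with ⟨h3, h4⟩ | ⟨h3, h4⟩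
    · exact ⟨(√2)⁻¹, h2, by simp [g, ← h3, ← h4]⟩
    · refine ⟨-(√2)⁻¹, neg_ne_zero.2 h2, ?_⟩
      simp only [g, Option.elim, ← h3, ← h4, neg_smul, ← smul_neg]
      congr 1
      simp
  have hmark : ∃ l, g (ι l) = h m := ⟨ι.symm none, by simp [g]⟩
  have hnorm : ∀ o, ‖g o‖ = 1 := by
    intro o
    cases o with
    | none => simp [g]
    | some e =>
      have h3 := norm_edge_sq (hpadj e).ne (s := -1) (by simp)
      have h4 : ‖(h (p e).1 + (-1 : ℝ) • h (p e).2 : E n)‖ = √2 := by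
        rw [← h3, Real.sqrt_sq (norm_nonneg _)]
      simp only [g, Option.elim, norm_smul, h4, norm_inv, Real.norm_eq_abs,
        abs_of_nonneg (Real.sqrt_nonneg 2)]
      exact inv_mul_cancel₀ (by positivity)
  refine ⟨fun l => g (ι l), ⟨fun l => hnorm (ι l), ?_⟩, fun l => ?_, hmark, hedge⟩
  · refine linearIndependent_of_top_le_span_of_card_eq_finrank ?_ (by simp)
    refine (eq_top_of_connected hΓ.connected (m := m) ?_ ?_).ge
    · obtain ⟨l, hl⟩ := hmark
      exact Submodule.subset_span ⟨l, hl⟩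
    · intro i j hij
      obtain ⟨l, a, ha, hl⟩ := hedge i j hij
      refine ⟨-1, by simp, ?_⟩
      have h3 : g (ι l) ∈ Submodule.span ℝ (Set.range fun l => g (ι l)) :=
        Submodule.subset_span ⟨l, rfl⟩
      have h5 := Submodule.smul_mem _ a⁻¹ h3
      rwa [hl, smul_smul, inv_mul_cancel₀ ha, one_smul] at h5
  · cases hl : ι l with
    | none => left; simp [g, hl]
    | some e => exact Or.inr ⟨_, _, hpadj e, (√2)⁻¹, h2, by simp [g, hl]⟩

lemma MarkedGraph.eq_of {S T : MarkedGraph n} (hmult : ∀ i j, S.mult i j = T.mult i j)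
    (hmarked : S.marked = T.marked) : S = T := by
  cases S
  cases T
  simp only [MarkedGraph.mk.injEq]
  exact ⟨funext fun i => funext fun j => hmult i j, hmarked⟩

lemma Family.exists_graph_eq {S : MarkedGraph n} (hS : S.IsMarkedTree) :
    ∃ Φ : Family n, Φ.IsEmbedded ∧ Φ.graph = S := by
  obtain ⟨hS1, hS2, m, hm, hm'⟩ := hS
  obtain ⟨f, hf, hf1, ⟨l₀, hl₀⟩, hf2⟩ := exists_system_of_isMarkedTree hS2 m
  have hΦ : hf.family.HasSystem f := ⟨hf, rfl⟩
  have hne : ∀ (l : Fin n) (c : ℝ) (v : E n), c • v = f l → c ≠ 0 := by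
    rintro l c v hc rfl
    have := hf.1 l
    simp [← hc] at this
  have hN1 : ∀ i, hf.family.HasNormal (h i) ↔ i = m := by
    intro i
    rw [hΦ.hasNormal_iff]
    constructor
    · rintro ⟨l, c, hc⟩
      have hc0 := hne _ _ _ hc
      rcases hf1 l with hl | ⟨p, q, hpq, a, ha, hl⟩
      · exact eq_of_smul_h_eq hc0 (b := 1) (by rw [hc, hl, one_smul])
      · exact absurd (hc.trans hl) (smul_h_ne_smul_edge hpq.ne (by simp) hc0)
    · rintro rfl
      exact ⟨l₀, 1, by rw [one_smul, hl₀]⟩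
  have hN2 : ∀ i j (s : ℝ), i ≠ j → (s = 1 ∨ s = -1) →
      (hf.family.HasNormal (h i + s • h j) ↔ s = -1 ∧ S.mult i j ≠ 0) := by
    intro i j s hij hs
    rw [hΦ.hasNormal_iff]
    constructor
    · rintro ⟨l, c, hc⟩
      have hc0 := hne _ _ _ hc
      rcases hf1 l with hl | ⟨p, q, hpq, a, ha, hl⟩
      · exact absurd (by rw [one_smul, hc, hl])
          (smul_h_ne_smul_edge hij hs one_ne_zero (m := m) (b := c))
      · obtain ⟨h1, h2⟩ := eq_of_smul_edge_eq hij hpq.ne hs (by simp) hc0 (hc.trans hl)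
        refine ⟨h2, ?_⟩
        have h3 : s(i, j) ∈ S.toSimpleGraph.edgeSet := h1 ▸ hpq
        exact h3
    · rintro ⟨rfl, hadj⟩
      obtain ⟨l, a, -, hl⟩ := hf2 i j hadj
      exact ⟨l, a, hl.symm⟩
  refine ⟨hf.family, hΦ.isEmbedded_iff.2 fun l => ?_, MarkedGraph.eq_of (fun i j => ?_) ?_⟩
  · rcases hf1 l with hl | ⟨p, q, hpq, a, ha, hl⟩
    · rw [hl]
      exact isRootLine_h m
    · rw [hl]
      exact (isRootLine_edge hpq.ne (by simp)).smul ha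
  · by_cases hij : i = j
    · subst hij
      rw [MarkedGraph.loopless, MarkedGraph.loopless]
    · have h1 : ¬ hf.family.HasNormal (h i + h j) := by
        have := (hN2 i j 1 hij (by simp)).not
        rw [one_smul] at this
        exact this.2 fun h => by norm_num at h
      have h2 : hf.family.HasNormal (h i - h j) ↔ S.mult i j ≠ 0 := by
        have := hN2 i j (-1) hij (by simp)
        simpa [sub_eq_add_neg] using this
      have h3 := hS1 i j
      simp only [Family.graph, hij, h1, h2, if_false]
      split_ifs <;> omega
  · ext i
    rw [Family.mem_marked_iff, hN1]
    exact ⟨fun h => h ▸ hm, hm' i⟩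

/-! ### The classification -/

lemma Family.generatesCopy_iff_isMarkedTree (hn : 2 ≤ n) {Φ : Family n} (hΦ : Φ.IsEmbedded) :
    Φ.GeneratesCopy (weylB n) ↔ Φ.graph.IsMarkedTree :=
  ⟨fun hG => Family.isMarkedTree_of_generates hn hΦ (Family.generates_of_generatesCopy hΦ hG),
    fun hT => (Family.generates_of_isMarkedTree hΦ hT).generatesCopy⟩

lemma Family.exists_weylB_of_isometric (hn : 2 ≤ n) {Φ Ψ : Family n} (hΦ : Φ.IsEmbedded)
    (hΨ : Ψ.IsEmbedded) (hG : Φ.GeneratesCopy (weylB n)) (hΦΨ : Family.Isometric Φ Ψ) :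
    ∃ w ∈ weylB n, Family.MapsTo w Φ Ψ := by
  have hG' := hG.of_isometric hΦΨ
  -- In the plane the given isometry may exchange short and long roots, so it is replaced by one
  -- built from the graphs; for `3 ≤ n` it lies in `weylB n` itself.
  rcases hn.eq_or_lt with rfl | hn3
  · have hΦT := (Family.generatesCopy_iff_isMarkedTree hn hΦ).1 hG
    have hΨT := (Family.generatesCopy_iff_isMarkedTree hn hΨ).1 hG'
    exact Family.exists_mapsTo_of_graph_iso hΦ hΦT hΨT (MarkedGraph.iso_of_two hΦT hΨT)
  · obtain ⟨U, hU⟩ := hΦΨ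
    exact ⟨U, mem_weylB_of_mapsTo hn3 (Family.generates_of_generatesCopy hΦ hG)
      (Family.generates_of_generatesCopy hΨ hG') hU, hU⟩

lemma Family.isometric_iff_graph_iso (hn : 2 ≤ n) {Φ Ψ : Family n} (hΦ : Φ.IsEmbedded)
    (hΨ : Ψ.IsEmbedded) (hΦT : Φ.graph.IsMarkedTree) (hΨT : Ψ.graph.IsMarkedTree) :
    Family.Isometric Φ Ψ ↔ MarkedGraph.Iso Φ.graph Ψ.graph := by
  constructor
  · intro hΦΨ
    obtain ⟨w, hw, hm⟩ := Family.exists_weylB_of_isometric hn hΦ hΨ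
      ((Family.generatesCopy_iff_isMarkedTree hn hΦ).2 hΦT) hΦΨ
    exact Family.graph_iso_of_mapsTo hΦT hΨT hw hm
  · intro hiso
    obtain ⟨w, -, hm⟩ := Family.exists_mapsTo_of_graph_iso hΦ hΦT hΨT hiso
    exact ⟨w, hm⟩

lemma exists_equiv_markedTree (hn : 2 ≤ n) :
    ∃ F : Quotient (familySetoid n) ≃ Quotient (markedTreeSetoid n),
      ∀ (Φ : Family n) (hB : Φ.GeneratesCopy (weylB n)) (_ : Φ.IsEmbedded)
        (hT : Φ.graph.IsMarkedTree),
        F (Quotient.mk (familySetoid n) ⟨Φ, hB⟩) =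
          Quotient.mk (markedTreeSetoid n) ⟨Φ.graph, hT⟩ := by
  -- The chosen embedded representative may differ from a family that is already embedded; `hF`
  -- shows that its graph is isomorphic nevertheless.
  choose e he1 he2 using fun Φ : BFamily n => Family.exists_isEmbedded Φ.2
  have heG : ∀ Φ, (e Φ).GeneratesCopy (weylB n) := fun Φ => Φ.2.of_isometric (he2 Φ)
  have heT : ∀ Φ, (e Φ).graph.IsMarkedTree := fun Φ =>
    (Family.generatesCopy_iff_isMarkedTree hn (he1 Φ)).1 (heG Φ)
  let E' : BFamily n → BFamily n := fun Φ => ⟨e Φ, heG Φ⟩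
  have hE : ∀ Φ, (familySetoid n).r Φ (E' Φ) := he2
  have key : ∀ Φ Ψ : BFamily n, (familySetoid n).r Φ Ψ ↔
      MarkedGraph.Iso (e Φ).graph (e Ψ).graph := by
    intro Φ Ψ
    rw [← Family.isometric_iff_graph_iso hn (he1 Φ) (he1 Ψ) (heT Φ) (heT Ψ)]
    have heqv := (familySetoid n).iseqv
    exact ⟨fun hr => heqv.trans (heqv.symm (hE Φ)) (heqv.trans hr (hE Ψ)),
      fun hr => heqv.trans (hE Φ) (heqv.trans (y := E' Ψ) hr (heqv.symm (hE Ψ)))⟩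
  let F : Quotient (familySetoid n) → Quotient (markedTreeSetoid n) :=
    Quotient.map (fun Φ => ⟨(e Φ).graph, heT Φ⟩) fun Φ Ψ hr => (key Φ Ψ).1 hr
  have hF : ∀ (Φ : Family n) (hB : Φ.GeneratesCopy (weylB n)) (_ : Φ.IsEmbedded)
      (hT : Φ.graph.IsMarkedTree), F (Quotient.mk (familySetoid n) ⟨Φ, hB⟩) =
        Quotient.mk (markedTreeSetoid n) ⟨Φ.graph, hT⟩ := by
    intro Φ hB hΦ hT
    refine Quotient.sound ((Family.isometric_iff_graph_iso hn (he1 _) hΦ (heT _) hT).1 ?_)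
    exact (familySetoid n).iseqv.symm (x := ⟨Φ, hB⟩) (y := E' ⟨Φ, hB⟩) (hE ⟨Φ, hB⟩)
  refine ⟨Equiv.ofBijective F ⟨?_, ?_⟩, hF⟩
  · intro a b
    induction a using Quotient.inductionOn with
    | _ Φ =>
      induction b using Quotient.inductionOn with
      | _ Ψ =>
        intro hab
        exact Quotient.sound ((key Φ Ψ).2 (Quotient.exact hab))
  · intro T
    induction T using Quotient.inductionOn with
    | _ T =>
      obtain ⟨S, hS⟩ := T
      obtain ⟨Φ, hΦ, rfl⟩ := Family.exists_graph_eq hS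
      exact ⟨_, hF Φ ((Family.generatesCopy_iff_isMarkedTree hn hΦ).2 hS) hΦ hS⟩

lemma Family.GeneratesCopy.card_eq {Φ : Family n} {G H : Subgroup (Isom n)}
    (hG : Φ.GeneratesCopy G) (hH : Φ.GeneratesCopy H) : Nat.card G = Nat.card H := by
  obtain ⟨U, hU⟩ := hG
  obtain ⟨V, hV⟩ := hH
  rw [← card_map_conj G U, hU.unique hV, card_map_conj]

/-- Groups with a common copy have equal order, which a proper subgroup of the finite group `weylB
n` cannot have. -/
lemma Family.not_generatesCopy_of_lt {R : Subgroup (Isom n)} (hR : R < weylB n) {Φ : Family n}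
    (hΦ : Φ.GeneratesCopy R) : ¬ Φ.GeneratesCopy (weylB n) := fun hB =>
  hR.ne (Subgroup.eq_of_le_of_card_ge hR.le (hB.card_eq hΦ).le)

end SphericalFamilies

open SphericalFamilies in
theorem theorem2 (n : ℕ) (hn : 2 ≤ n) :
    -- every family generating `B_n` is isometric to one with all normals in `Δ(B_n)`
    (∀ Φ : Family n, Φ.GeneratesCopy (weylB n) →
      ∃ Ψ : Family n, Ψ.IsEmbedded ∧ Family.Isometric Φ Ψ) ∧
    -- an embedded family generates `B_n` iff its graph is a tree with exactly one marked vertex,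
    -- iff it generates the whole of the Weyl group of `Δ(B_n)`
    (∀ Φ : Family n, Φ.IsEmbedded →
      (Φ.GeneratesCopy (weylB n) ↔ Φ.graph.IsMarkedTree) ∧
      (Φ.Generates (weylB n) ↔ Φ.graph.IsMarkedTree)) ∧
    -- the graph induces a bijection between families generating `B_n` and marked trees
    (∃ F : Quotient (familySetoid n) ≃ Quotient (markedTreeSetoid n),
      ∀ (Φ : Family n) (hB : Φ.GeneratesCopy (weylB n)) (_ : Φ.IsEmbedded)
        (hT : Φ.graph.IsMarkedTree),
        F (Quotient.mk (familySetoid n) ⟨Φ, hB⟩) =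
          Quotient.mk (markedTreeSetoid n) ⟨Φ.graph, hT⟩) ∧
    -- for embedded families, isometric means equivalent under the Weyl group
    (∀ Φ Ψ : Family n, Φ.IsEmbedded → Ψ.IsEmbedded → Φ.GeneratesCopy (weylB n) →
      (Family.Isometric Φ Ψ ↔ ∃ w ∈ weylB n, Family.MapsTo w Φ Ψ)) ∧
    -- other reflection subgroups of maximal rank are excluded
    (∀ R : Subgroup (Isom n), IsReflectionGroup R → IsMaximalRank R → R < weylB n →
      ∀ Φ : Family n, Φ.GeneratesCopy R →
        ¬ Φ.GeneratesCopy (weylB n) ∧ (Φ.IsEmbedded → ¬ Φ.graph.IsMarkedTree)) ∧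
    -- `D_n` is one of them
    (IsReflectionGroup (weylD n) ∧ IsMaximalRank (weylD n) ∧ weylD n < weylB n) := by
  refine ⟨fun Φ hG => Family.exists_isEmbedded hG, fun Φ hΦ => ⟨?_, ?_⟩,
    exists_equiv_markedTree hn, fun Φ Ψ hΦ hΨ hG => ⟨?_, ?_⟩, fun R _ _ hR Φ hΦ => ⟨?_, ?_⟩,
    isReflectionGroup_weylD n, isMaximalRank_weylD hn, weylD_lt_weylB hn⟩
  · exact Family.generatesCopy_iff_isMarkedTree hn hΦ
  · exact ⟨Family.isMarkedTree_of_generates hn hΦ, Family.generates_of_isMarkedTree hΦ⟩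
  · exact Family.exists_weylB_of_isometric hn hΦ hΨ hG
  · rintro ⟨w, -, hw⟩
    exact ⟨w, hw⟩
  · exact Family.not_generatesCopy_of_lt hR hΦ
  · exact fun hE hT => Family.not_generatesCopy_of_lt hR hΦ
      ((Family.generatesCopy_iff_isMarkedTree hn hE).2 hT)
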